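/- **Conventions.** $\mathbb F\subseteq\mathbb C$ is a subfield closed under complex conjugation and under square roots of its positive real elements; $d\ge 2$ and $r\ge 1$ are integers. For a matrix $P(z)=\sum_k P_kz^k$ of Laurent polynomials put $P^*(z)=\sum_k \overline{P_k}^{T}z^{-k}$; a square $P$ is *paraunitary* if $PP^*=I$. A Laurent polynomial $p$ has *symmetry pattern* $\varepsilon z^{c}$ ($\varepsilon=\pm1$, $c\in\mathbb Z$) if $p(z)=\varepsilon z^{c}p(1/z)$; the zero polynomial has every pattern. A matrix has the pattern $[\varepsilon_1z^{k_1},\dots]^T[\eta_1z^{t_1},\dots]$ if its $(i,j)$ entry has the pattern $\varepsilon_i\eta_jz^{k_i+t_j}$ (this is compatible symmetry). The length $|\mathrm{coeffsupp}(p)|$ is the highest minus the lowest exponent occurring in $p$, and $-\infty$ if $p=0$; for a vector, one takes the exponents occurring in any entry. A filter is an $r\times r$ matrix of Laurent polynomials $a(z)=\sum_k a(k)z^k$ with subsymbols $a_{;\gamma}(z)=\sqrt d\sum_k a(\gamma+dk)z^k$, $0\le\gamma<d$. The polyphase matrix of filters $a_0,\dots,a_{d-1}$ is the block matrix $(a_{m;\gamma})_{0\le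 m,\gamma\le d-1}$. **Input.** A filter $a_0$ with coefficients in $\mathbb F$ that is $d$-band orthogonal, $\sum_{\gamma=0}^{d-1}a_{0;\gamma}a_{0;\gamma}^*=I_r$, and has the symmetry $$a_0(z)=\mathrm{diag}(\varepsilon_1z^{dc_1},\dots,\varepsilon_rz^{dc_r})\,a_0(1/z)\,\mathrm{diag}(\varepsilon_1z^{-c_1},\dots,\varepsilon_rz^{-c_r})$$ with $\varepsilon_\ell\in\{-1,1\}$, $c_\ell\in\mathbb R$ and $dc_\ell-c_j\in\mathbb Z$ for all $\ell,j$. Write $dc_\ell-c_j-\gamma=dR^\gamma_{\ell,j}+Q^\gamma_j$ with $R^\gamma_{\ell,j}\in\mathbb Z$ and $Q^\gamma_j\in\{0,\dots,d-1\}$ (the remainder does not depend on $\ell$). **Step 1.** There are integers $\kappa_{j,\gamma}$ with $\kappa_{j,Q^\gamma_j}=-\kappa_{j,\gamma}$ such that each $\kappa=\kappa_{j,\gamma}$ minimizes the length of the coefficient support of $[a_{0;\gamma}]_{:,j}+z^{\kappa}[a_{0;Q^\gamma_j}]_{:,j}$ over $\kappa\in\mathbb Z$. Moreover, for *every* family of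 integers with $\kappa_{j,Q^\gamma_j}=-\kappa_{j,\gamma}$ (minimizing or not), let $U$ be the $dr\times dr$ matrix for which $P:=[a_{0;0},\dots,a_{0;d-1}]\,U=[b_{0;0},\dots,b_{0;d-1}]$ has the columns $$[b_{0;\gamma}]_{:,j}=\begin{cases}[a_{0;\gamma}]_{:,j},&\gamma=Q^\gamma_j,\\ \tfrac1{\sqrt2}\bigl([a_{0;\gamma}]_{:,j}+z^{\kappa_{j,\gamma}}[a_{0;Q^\gamma_j}]_{:,j}\bigr),&\gamma<Q^\gamma_j,\\ \tfrac1{\sqrt2}\bigl([a_{0;\gamma}]_{:,j}-z^{\kappa_{j,\gamma}}[a_{0;Q^\gamma_j}]_{:,j}\bigr),&\gamma>Q^\gamma_j\end{cases}$$ (the same linear formula being applied to the columns of any row matrix). Then $U$ is paraunitary with coefficients in $\mathbb F$; there are integers $k_\ell,t_{\gamma,j}$ with $k_\ell+t_{\gamma,j}=R^\gamma_{\ell,j}+\kappa_{j,\gamma}$ for all $\ell,j,\gamma$; and for any such integers $P$ has the pattern $[\varepsilon_1z^{k_1},\dots,\varepsilon_rz^{k_r}]^T\sigma$, where the row $\sigma$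 has the entries $\sigma_{\gamma,j}=\mathrm{sgn}(Q^\gamma_j-\gamma)\,\varepsilon_j\,z^{t_{\gamma,j}}$, with $\mathrm{sgn}(x)=1$ for $x\ge0$ and $\mathrm{sgn}(x)=-1$ for $x<0$. **Step 2.** For any such $\kappa$, $k$, $t$ there is a $dr\times dr$ paraunitary matrix $P_e$ with coefficients in $\mathbb F$, whose first $r$ rows form $P$, which has a pattern $$[\varepsilon_1z^{k_1},\dots,\varepsilon_rz^{k_r},\varepsilon^1_1z^{k^1_1},\dots,\varepsilon^1_rz^{k^1_r},\dots,\varepsilon^{d-1}_1z^{k^{d-1}_1},\dots,\varepsilon^{d-1}_rz^{k^{d-1}_r}]^T\sigma\qquad(\ast)$$ with $\varepsilon^m_\ell\in\{-1,1\}$, $k^m_\ell\in\mathbb Z$, and whose coefficient support is controlled by $$|\mathrm{coeffsupp}([P_e]_{i,j})|\le\max\Bigl(0,\max_{1\le n\le r}|\mathrm{coeffsupp}([P]_{n,j})|\Bigr),\qquad 1\le i,j\le dr.$$ **Step 3.** For *every* $dr\times dr$ paraunitary $P_e$ with coefficients in $\mathbb F$, first $r$ rows $P$ and a pattern $(\ast)$,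 write $P_eU^*=(a_{m;\gamma})_{0\le m,\gamma\le d-1}$ in $r\times r$ blocks and put $$a_m(z)=\frac1{\sqrt d}\sum_{\gamma=0}^{d-1}a_{m;\gamma}(z^d)z^\gamma,\qquad m=0,\dots,d-1.$$ For $m=0$ this gives back the input filter $a_0$; the polyphase matrix of $a_0,\dots,a_{d-1}$ is $P_eU^*$ and is paraunitary; and for $m=1,\dots,d-1$ the filter $a_m$ has coefficients in $\mathbb F$ and the symmetry $$a_m(z)=\mathrm{diag}(\varepsilon^m_1z^{dc^m_1},\dots,\varepsilon^m_rz^{dc^m_r})\,a_m(1/z)\,\mathrm{diag}(\varepsilon_1z^{-c_1},\dots,\varepsilon_rz^{-c_r}),\qquad c^m_\ell=(k^m_\ell-k_\ell)+c_\ell,$$ where all $dc^m_\ell-c_j$ are integers. -/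

import Mathlib

open LaurentPolynomial

noncomputable section

/-- `r × s` matrices of Laurent polynomials with complex coefficients; `T n` is the monomial `zⁿ`.
A finitely supported sequence of `r × r` matrices is identified with its symbol `∑ₖ a(k) zᵏ`. -/
abbrev LMat (m n : Type*) := Matrix m n ℂ[T;T⁻¹]

/-- All coefficients of the entries lie in the subfield `F`. -/
def CoeffsIn {m n : Type*} (F : Subfield ℂ) (M : LMat m n) : Prop :=
  ∀ i j (k : ℤ), (M i j).coeff k ∈ F

/-- For `p = ∑ pₖ zᵏ` this is `∑ conj(pₖ) z⁻ᵏ`. -/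
def lstar (p : ℂ[T;T⁻¹]) : ℂ[T;T⁻¹] :=
  invert (AddMonoidAlgebra.mapRingHom ℤ (starRingEnd ℂ) p)

/-- `P*(z) = ∑ Pₖ* z⁻ᵏ`, where `Pₖ*` is the conjugate transpose of the coefficient matrix. -/
def pstar {m n : Type*} (M : LMat m n) : LMat n m :=
  Matrix.of fun j i => lstar (M i j)

/-- `M M* = I`. For a square matrix: `M` is paraunitary. -/
def IsParaunitary {m n : Type*} [Fintype n] [DecidableEq m] (M : LMat m n) : Prop :=
  M * pstar M = 1

/-- `p(z) = ε zᶜ p(1/z)`. For `p ≠ 0` this says that `p(z) / p(1/z) = ε zᶜ`; the zero polynomial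
has every symmetry pattern. -/
def HasSym (p : ℂ[T;T⁻¹]) (ε : ℤˣ) (c : ℤ) : Prop :=
  p = C ((ε : ℤ) : ℂ) * T c * invert p

/-- The symmetry pattern of `M` is the product of the column `ρ` and the row `σ`, where a pair
`(ε, c)` stands for `ε zᶜ`. (Every pair is the symmetry pattern of some nonzero Laurent polynomial,
so the matrices with such a pattern are those with compatible symmetry.) -/
def HasSymPattern {m n : Type*} (M : LMat m n) (ρ : m → ℤˣ × ℤ) (σ : n → ℤˣ × ℤ) : Prop :=
  ∀ i j, HasSym (M i j) ((ρ i).1 * (σ j).1) ((ρ i).2 + (σ j).2)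

/-- The length `n - m` of the smallest interval `[m, n]` that contains `S`, and `⊥` (that is, `-∞`)
if `S` is empty. -/
def finsetLength (S : Finset ℤ) : WithBot ℤ :=
  if h : S.Nonempty then ((S.max' h - S.min' h : ℤ) : WithBot ℤ) else ⊥

/-- Length of the coefficient support of a Laurent polynomial. -/
def coeffLength (p : ℂ[T;T⁻¹]) : WithBot ℤ :=
  finsetLength p.coeff.support

/-- Length of the coefficient support of a vector of Laurent polynomials. -/
def vecCoeffLength {m : Type*} [Fintype m] (v : m → ℂ[T;T⁻¹]) : WithBot ℤ :=
  finsetLength (Finset.univ.biUnion fun i => (v i).coeff.support)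

theorem residue_injective (d : ℕ) [NeZero d] (γ : ℤ) :
    Function.Injective fun k : ℤ => γ + (d : ℤ) * k := by
  intro x y h
  have hd : (d : ℤ) ≠ 0 := by exact_mod_cast NeZero.ne d
  exact mul_left_cancel₀ hd (add_left_cancel h)

/-- The `d`-band subsymbol `√d ∑ₖ a(γ + d k) zᵏ` of a filter. -/
def subsymbol {r : ℕ} (d : ℕ) [NeZero d] (a : LMat (Fin r) (Fin r)) (γ : ℤ) :
    LMat (Fin r) (Fin r) :=
  Matrix.of fun l j => C ((√(d : ℝ) : ℝ) : ℂ) *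
    AddMonoidAlgebra.comapDomain (fun k : ℤ => γ + (d : ℤ) * k) (residue_injective d γ) (a l j)

/-- The row `[a_{;0}, …, a_{;d-1}]` of all subsymbols of one filter. -/
def polyphaseRow {r : ℕ} (d : ℕ) [NeZero d] (a : LMat (Fin r) (Fin r)) :
    LMat (Fin r) (Fin d × Fin r) :=
  Matrix.of fun l q => subsymbol d a (q.1 : ℕ) l q.2

/-- The polyphase matrix of a family of `d` filters, with `r × r` blocks `a_{m;γ}`. -/
def polyphase {r : ℕ} (d : ℕ) [NeZero d] (a : Fin d → LMat (Fin r) (Fin r)) :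
    LMat (Fin d × Fin r) (Fin d × Fin r) :=
  Matrix.of fun p q => subsymbol d (a p.1) (q.1 : ℕ) p.2 q.2

/-- `d`-band orthogonality: `∑_γ a_{;γ} a_{;γ}* = I_r`. -/
def IsOrthogonalFilter {r : ℕ} (d : ℕ) [NeZero d] (a : LMat (Fin r) (Fin r)) : Prop :=
  ∑ γ : Fin d, subsymbol d a (γ : ℕ) * pstar (subsymbol d a (γ : ℕ)) = 1

/-- `a(z) = diag(ε'_l z^{d c'_l}) a(1/z) diag(ε_j z^{-c_j})` with real `c', c` such that all
`d c'_l - c_j` are integers. -/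
def FilterSym {r : ℕ} (d : ℕ) (a : LMat (Fin r) (Fin r)) (ε' : Fin r → ℤˣ) (c' : Fin r → ℝ)
    (ε : Fin r → ℤˣ) (c : Fin r → ℝ) : Prop :=
  ∀ l j, ∃ n : ℤ, (n : ℝ) = d * c' l - c j ∧ HasSym (a l j) (ε' l * ε j) n

/-- The remainder `Q ∈ {0, …, d-1}` in `d c_l - c_j - γ = d R + Q`, for `d c_l - c_j ∈ ℤ`. -/
def reflRem {r : ℕ} (d : ℕ) [NeZero d] (c : Fin r → ℝ) (l j : Fin r) (γ : Fin d) : Fin d :=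
  ⟨((⌊(d : ℝ) * c l - c j⌋ - ((γ : ℕ) : ℤ)) % (d : ℤ)).toNat, by
    have hd : 0 < (d : ℤ) := by exact_mod_cast Nat.pos_of_ne_zero (NeZero.ne d)
    have h1 := Int.emod_nonneg (⌊(d : ℝ) * c l - c j⌋ - ((γ : ℕ) : ℤ)) hd.ne'
    have h2 := Int.emod_lt_of_pos (⌊(d : ℝ) * c l - c j⌋ - ((γ : ℕ) : ℤ)) hd
    omega⟩

/-- The quotient `R ∈ ℤ` in `d c_l - c_j - γ = d R + Q`, for `d c_l - c_j ∈ ℤ`. -/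
def reflQuot {r : ℕ} (d : ℕ) (c : Fin r → ℝ) (l j : Fin r) (γ : Fin d) : ℤ :=
  (⌊(d : ℝ) * c l - c j⌋ - ((γ : ℕ) : ℤ)) / (d : ℤ)

theorem reflRem_spec {r : ℕ} (d : ℕ) [NeZero d] (c : Fin r → ℝ) (l j : Fin r) (γ : Fin d)
    (n : ℤ) (hn : (n : ℝ) = d * c l - c j) :
    (d : ℝ) * c l - c j - (γ : ℕ) = d * (reflQuot d c l j γ : ℝ) + (reflRem d c l j γ : ℕ) := by
  have hd : 0 < (d : ℤ) := by exact_mod_cast Nat.pos_of_ne_zero (NeZero.ne d)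
  have h1 := Int.emod_nonneg (⌊(d : ℝ) * c l - c j⌋ - ((γ : ℕ) : ℤ)) hd.ne'
  have h2 := Int.mul_ediv_add_emod (⌊(d : ℝ) * c l - c j⌋ - ((γ : ℕ) : ℤ)) d
  have h3 : (((reflRem d c l j γ : Fin d) : ℕ) : ℤ)
      = (⌊(d : ℝ) * c l - c j⌋ - ((γ : ℕ) : ℤ)) % (d : ℤ) := by
    simp only [reflRem]
    exact Int.toNat_of_nonneg h1
  have h4 : n - ((γ : ℕ) : ℤ)
      = d * reflQuot d c l j γ + (((reflRem d c l j γ : Fin d) : ℕ) : ℤ) := by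
    rw [h3, reflQuot, h2, ← hn, Int.floor_intCast]
  rw [← hn]
  exact_mod_cast h4

/-- Under the integrality of all `d c_l - c_j` the remainder does not depend on `l`. -/
theorem reflRem_indep {r : ℕ} (d : ℕ) [NeZero d] (c : Fin r → ℝ)
    (hc : ∀ l j, ∃ n : ℤ, (n : ℝ) = d * c l - c j) (l l' j : Fin r) (γ : Fin d) :
    reflRem d c l j γ = reflRem d c l' j γ := by
  obtain ⟨n, hn⟩ := hc l j
  obtain ⟨n', hn'⟩ := hc l' j
  obtain ⟨u, hu⟩ := hc l l
  obtain ⟨v, hv⟩ := hc l l'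
  have key : n = n' + d * (v - u) := by
    have : (n : ℝ) = n' + d * (v - u) := by rw [hn, hn', hu, hv]; ring
    exact_mod_cast this
  apply Fin.ext
  simp only [reflRem]
  rw [← hn, ← hn', Int.floor_intCast, Int.floor_intCast, key,
    show n' + (d : ℤ) * (v - u) - ((γ : ℕ) : ℤ) = n' - ((γ : ℕ) : ℤ) + d * (v - u) by ring,
    Int.add_mul_emod_self_left]

/-- `Q_j^γ`, the common value of the remainders `Q_{l,j}^γ`. -/
def reflIdx {r : ℕ} (d : ℕ) [NeZero d] (c : Fin r → ℝ) (j : Fin r) (γ : Fin d) : Fin d :=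
  reflRem d c j j γ

/-- The integers `κ_{j,γ}` used to pair column `j` of `a_{0;γ}` with column `j` of `a_{0;Q}` and
those used to pair them in the other order are opposite: `κ_{j,Q_j^γ} = -κ_{j,γ}`. -/
def IsShift {r : ℕ} (d : ℕ) [NeZero d] (c : Fin r → ℝ) (κ : Fin r → Fin d → ℤ) : Prop :=
  ∀ j γ, κ j (reflIdx d c j γ) = -κ j γ

/-- Each `κ_{j,γ}` makes the coefficient support of
`[a_{0;γ}]_{:,j} + z^κ [a_{0;Q}]_{:,j}` as short as possible. -/
def IsMinimalShift {r : ℕ} (d : ℕ) [NeZero d] (a₀ : LMat (Fin r) (Fin r)) (c : Fin r → ℝ)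
    (κ : Fin r → Fin d → ℤ) : Prop :=
  ∀ (j : Fin r) (γ : Fin d) (n : ℤ),
    vecCoeffLength (fun l => subsymbol d a₀ (γ : ℕ) l j
        + T (κ j γ) * subsymbol d a₀ (reflIdx d c j γ : ℕ) l j)
      ≤ vecCoeffLength (fun l => subsymbol d a₀ (γ : ℕ) l j
        + T n * subsymbol d a₀ (reflIdx d c j γ : ℕ) l j)

/-- The matrix `U` for which column `(γ, j)` of `A U` is
`A_{(γ,j)}` if `γ = Q`, `(A_{(γ,j)} + z^κ A_{(Q,j)}) / √2` if `γ < Q`, and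
`(A_{(γ,j)} - z^κ A_{(Q,j)}) / √2` if `γ > Q`, where `Q = Q_j^γ` and `κ = κ_{j,γ}`. -/
def symmetrizer {r : ℕ} (d : ℕ) [NeZero d] (c : Fin r → ℝ) (κ : Fin r → Fin d → ℤ) :
    LMat (Fin d × Fin r) (Fin d × Fin r) :=
  Matrix.of fun p q =>
    let Q := reflIdx d c q.2 q.1
    let e : ℂ[T;T⁻¹] := if p = q then 1 else 0
    let f : ℂ[T;T⁻¹] := if p = (Q, q.2) then T (κ q.2 q.1) else 0
    if q.1 = Q then e
    else if q.1 < Q then C (((√2 : ℝ) : ℂ)⁻¹) * (e + f)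
    else C (((√2 : ℝ) : ℂ)⁻¹) * (e - f)

/-- `sgn(Q_j^γ - γ)`, with `sgn 0 = 1`. -/
def reflSign {r : ℕ} (d : ℕ) [NeZero d] (c : Fin r → ℝ) (j : Fin r) (γ : Fin d) : ℤˣ :=
  if γ ≤ reflIdx d c j γ then 1 else -1

/-- The exponents `R_{l,j}^γ + κ_{j,γ}` are split as `k_l + t_{γ,j}`. -/
def IsExponentSplit {r : ℕ} (d : ℕ) (c : Fin r → ℝ) (κ : Fin r → Fin d → ℤ)
    (k : Fin r → ℤ) (t : Fin d × Fin r → ℤ) : Prop :=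
  ∀ l j γ, k l + t (γ, j) = reflQuot d c l j γ + κ j γ

/-- `Pe` is a square paraunitary matrix with coefficients in `F` whose first block row is `P` and
whose symmetry pattern is `[E_{m,l} z^{K_{m,l}}]ᵀ σ`, the rows of block `0` carrying the
prescribed pattern `ρ_l = (E_{0,l}, K_{0,l})`. -/
structure IsSymExtension {r d : ℕ} [NeZero d] (F : Subfield ℂ) (P : LMat (Fin r) (Fin d × Fin r))
    (ρ : Fin r → ℤˣ × ℤ) (σ : Fin d × Fin r → ℤˣ × ℤ)
    (Pe : LMat (Fin d × Fin r) (Fin d × Fin r)) (E : Fin d × Fin r → ℤˣ) (K : Fin d × Fin r → ℤ) :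
    Prop where
  coeffs : CoeffsIn F Pe
  top : ∀ l q, Pe (0, l) q = P l q
  paraunitary : IsParaunitary Pe
  top_pattern : ∀ l, (E (0, l), K (0, l)) = ρ l
  pattern : HasSymPattern Pe (fun p => (E p, K p)) σ

/-- `a_m(z) = (1/√d) ∑_γ A_{m;γ}(z^d) z^γ`, for a `d × d` block matrix `A` with blocks `A_{m;γ}`. -/
def filterOfPolyphase {r : ℕ} (d : ℕ) (A : LMat (Fin d × Fin r) (Fin d × Fin r)) (m : Fin d) :
    LMat (Fin r) (Fin r) :=
  Matrix.of fun l j => C (((√(d : ℝ) : ℝ) : ℂ)⁻¹) *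
    ∑ γ : Fin d,
      AddMonoidAlgebra.mapDomain (fun n : ℤ => (d : ℤ) * n) (A (m, l) (γ, j)) * T ((γ : ℕ) : ℤ)

end

/-!
The involution `p ↦ p*` makes the Laurent polynomials a star ring, in which `P*` is the conjugate
transpose `Pᴴ`.

*Bookkeeping with the subsymbols.* A filter entry has the symmetry `ε z^N` if and only if its
subsymbols satisfy `a_γ(z) = ε z^R a_Q(1/z)` with `N - γ = d R + Q` (`hasSym_iff_subsymbol_coeff`).
Now `γ ↦ Q` is an involution, and `U` replaces the two reflected columns of a pair by their sum
and difference, up to monomials and the factor `1/√2`. So `U` is paraunitary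
(`isParaunitary_symmetrizer`), it turns columns that are reflected into each other into symmetric
columns (`hasSym_mul_symmetrizer`), and `U*` does the reverse
(`coeff_mul_symmetrizer_conjTranspose`). This gives the symmetry of `P` and that of the new filters.

*Extension of the matrix.* It remains to complete orthonormal rows with compatible symmetry to a
paraunitary matrix with compatible symmetry (`exists_completion_of_hasSymPattern`). The centers of
symmetry are half-integers; with `z = w²` and multiplication by monomials in `w` they all move to
the exponent `L_j` in column `j`, where `L_j` bounds the lengths. The rows then have exponents in
`[0, 2 L_j]` only. The price is a grading: under `w ↦ -w` the rows and columns change by signs, and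
only rows with such a behaviour come from Laurent polynomials in `z`.

Completing rows `Q` without negative exponents and with `Q(0)` of full row rank are found by
splitting off paraunitary factors `I - E + w E` (`exists_completion`). Every row orthogonal to `P`
without negative exponents is a combination of the rows of `Q` with coefficients without negative
exponents (`eq_mul_of_completion`). Hence the degrees of `Q` are at most `2 L_j`, the grading acts on `Q` by a
constant matrix, and the reflection acts on `Q` by a matrix `G`, polynomial in `w`, that is
paraunitary with Hermitian coefficients (`IsGradedReflection`).

The rest is a change of basis that makes `G` constant. The product of the lowest and the highest
coefficient of `G` is zero. If `E` is the projection onto the even or the odd part of the range of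
the highest coefficient, then `E G(0) = 0`, and `E G₁ E = 0` since `G₁` is odd for the grading; so
`(I - E + w⁻¹E) G (I - E + w⁻¹E)` is again polynomial (`IsGradedReflection.reduce`). Treating the
even and the odd part in turn lowers the degree (`IsGradedReflection.factors`). At degree zero the
reflection and the grading are commuting Hermitian involutions, and a common orthonormal eigenbasis
over `F` (`exists_orthonormal_eigenvectors`) consists of the rows that were sought.
-/

open scoped Matrix

/-! ### Laurent polynomials with an involution -/

theorem lstar_coeff (p : ℂ[T;T⁻¹]) (n : ℤ) :
    (lstar p).coeff n = (starRingEnd ℂ) (p.coeff (-n)) := by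
  simp [lstar]

/-- The involution `∑ pₖ zᵏ ↦ ∑ conj(pₖ) z⁻ᵏ`, for which `P*` is the conjugate transpose of `P`. -/
noncomputable instance laurentStarRing : StarRing ℂ[T;T⁻¹] where
  star := lstar
  star_involutive p := by ext n; simp [lstar_coeff]
  star_mul p q := by simp only [lstar, map_mul]; exact mul_comm _ _
  star_add p q := by simp [lstar, map_add]

theorem star_coeff (p : ℂ[T;T⁻¹]) (n : ℤ) :
    (star p).coeff n = star (p.coeff (-n)) := lstar_coeff p n

@[simp] theorem star_T (n : ℤ) : star (T n : ℂ[T;T⁻¹]) = T (-n) := by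
  ext k
  rw [star_coeff, T_apply, T_apply]
  by_cases h : n = -k
  · simp [h]
  · have : ¬ -n = k := fun h' => h (by omega)
    simp [h, this]

@[simp] theorem star_C (a : ℂ) : star (C a : ℂ[T;T⁻¹]) = C (star a) := by
  ext k
  rw [star_coeff, C_apply, C_apply]
  by_cases h : k = 0 <;> simp [h]

theorem coeff_T_mul (n : ℤ) (p : ℂ[T;T⁻¹]) (k : ℤ) : (T n * p).coeff k = p.coeff (k - n) := by
  rw [T, AddMonoidAlgebra.coeff_single_mul_apply]
  simp [sub_eq_neg_add]

theorem coeff_C_mul (a : ℂ) (p : ℂ[T;T⁻¹]) (k : ℤ) : (C a * p).coeff k = a * p.coeff k := by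
  rw [← smul_eq_C_mul]; simp

theorem invert_star (p : ℂ[T;T⁻¹]) : invert (star p) = star (invert p) := by
  ext k; simp [star_coeff]

/-- The substitution `w ↦ -w`. -/
noncomputable def negSubst : ℂ[T;T⁻¹] →+* ℂ[T;T⁻¹] :=
  eval₂ (C : ℂ →+* ℂ[T;T⁻¹]) ⟨-T 1, -T (-1), by rw [neg_mul_neg, ← T_add]; rfl,
    by rw [neg_mul_neg, ← T_add]; rfl⟩

theorem negSubst_C (a : ℂ) : negSubst (C a) = C a := by simp [negSubst]

theorem negSubst_T (n : ℤ) : negSubst (T n) = C ((-1 : ℂ) ^ n) * T n := by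
  have key : ∀ n : ℕ, negSubst (T n) = C ((-1 : ℂ) ^ n) * T n := by
    intro n
    have : (T n : ℂ[T;T⁻¹]) = T 1 ^ n := by simp
    rw [this, map_pow]
    have h1 : negSubst (T 1) = - T 1 := by simp [negSubst]
    rw [h1, neg_pow]; simp
  obtain ⟨m, rfl | rfl⟩ := n.eq_nat_or_neg
  · simpa using key m
  · have h1 : negSubst (T (-(m : ℤ))) * negSubst (T m) = 1 := by
      rw [← map_mul, ← T_add]; simp
    have h2 : (C ((-1 : ℂ) ^ (-(m : ℤ))) * T (-(m : ℤ))) * negSubst (T m) = 1 := by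
      rw [key m]
      calc _ = C ((-1 : ℂ) ^ (-(m : ℤ)) * (-1 : ℂ) ^ m) * (T (-(m : ℤ)) * T m) := by
            rw [map_mul]; ring
        _ = 1 := by
            rw [← T_add, ← zpow_natCast, ← zpow_add₀ (by norm_num)]; simp
    have h3 : negSubst (T m) * negSubst (T (-(m : ℤ))) = 1 := by rw [mul_comm]; exact h1
    calc _ = (C ((-1 : ℂ) ^ (-(m : ℤ))) * T (-(m : ℤ))) * negSubst (T m) *
          negSubst (T (-(m : ℤ))) := by rw [h2, one_mul]
      _ = _ := by rw [mul_assoc, h3, mul_one]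

theorem negSubst_coeff (p : ℂ[T;T⁻¹]) (k : ℤ) :
    (negSubst p).coeff k = (-1 : ℂ) ^ k * p.coeff k := by
  induction p using LaurentPolynomial.induction_on' with
  | add p q hp hq => simp [hp, hq, mul_add]
  | C_mul_T n a =>
    rw [map_mul, negSubst_C, negSubst_T, coeff_C_mul, coeff_C_mul, coeff_C_mul, T_apply]
    by_cases h : n = k
    · subst h; simp; ring
    · simp [h]

theorem neg_one_zpow_neg (k : ℤ) : (-1 : ℂ) ^ (-k) = (-1 : ℂ) ^ k := by
  rw [_root_.zpow_neg, ← inv_zpow]; norm_num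

theorem star_neg_one_zpow (k : ℤ) : star ((-1 : ℂ) ^ k) = (-1 : ℂ) ^ k := by
  simp

theorem negSubst_star (p : ℂ[T;T⁻¹]) : negSubst (star p) = star (negSubst p) := by
  ext k
  rw [star_coeff, negSubst_coeff, negSubst_coeff, star_coeff, star_mul', neg_one_zpow_neg,
    star_neg_one_zpow]

theorem negSubst_invert (p : ℂ[T;T⁻¹]) : negSubst (invert p) = invert (negSubst p) := by
  ext k
  rw [negSubst_coeff, invert_apply, invert_apply, negSubst_coeff, neg_one_zpow_neg]

/-! ### Matrices with entries in a subring -/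

/-- All entries of `M` lie in the subring `S`. -/
def EntriesIn {R m n : Type*} [Ring R] (S : Subring R) (M : Matrix m n R) : Prop :=
  ∀ i j, M i j ∈ S

namespace EntriesIn

variable {R l m n : Type*} [Ring R] {S : Subring R}

theorem add {M N : Matrix m n R} (hM : EntriesIn S M) (hN : EntriesIn S N) : EntriesIn S (M + N) :=
  fun i j => S.add_mem (hM i j) (hN i j)

theorem sub {M N : Matrix m n R} (hM : EntriesIn S M) (hN : EntriesIn S N) : EntriesIn S (M - N) :=
  fun i j => S.sub_mem (hM i j) (hN i j)

theorem mul [Fintype m] {M : Matrix l m R} {N : Matrix m n R} (hM : EntriesIn S M)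
    (hN : EntriesIn S N) : EntriesIn S (M * N) :=
  fun i j => by
    rw [Matrix.mul_apply]
    exact S.sum_mem fun k _ => S.mul_mem (hM i k) (hN k j)

theorem one [DecidableEq m] : EntriesIn S (1 : Matrix m m R) := fun i j => by
  rw [Matrix.one_apply]; split_ifs
  · exact S.one_mem
  · exact S.zero_mem

theorem conjTranspose [StarRing R] (hS : ∀ x ∈ S, star x ∈ S) {M : Matrix m n R}
    (hM : EntriesIn S M) : EntriesIn S Mᴴ := fun i j => hS _ (hM j i)

end EntriesIn

/-- The Laurent polynomials with coefficients in the subfield `F`. -/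
noncomputable def coeffSubring (F : Subfield ℂ) : Subring ℂ[T;T⁻¹] :=
  (AddMonoidAlgebra.mapRingHom ℤ F.subtype).range

theorem mem_coeffSubring {F : Subfield ℂ} {p : ℂ[T;T⁻¹]} :
    p ∈ coeffSubring F ↔ ∀ k, p.coeff k ∈ F := by
  have := AddMonoidAlgebra.range_map (M := ℤ) (F.subtype : F →+* ℂ).toAddMonoidHom
  have h2 := Set.ext_iff.1 this p
  rw [coeffSubring, RingHom.mem_range]
  exact h2.trans (forall_congr' fun k => by simp)

theorem coeffsIn_iff {F : Subfield ℂ} {m n : Type*} {M : LMat m n} :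
    CoeffsIn F M ↔ EntriesIn (coeffSubring F) M :=
  forall₂_congr fun _ _ => mem_coeffSubring.symm

theorem star_mem_coeffSubring {F : Subfield ℂ} (hF : ∀ x ∈ F, (starRingEnd ℂ) x ∈ F)
    {p : ℂ[T;T⁻¹]} (hp : p ∈ coeffSubring F) : star p ∈ coeffSubring F := by
  rw [mem_coeffSubring] at *
  intro k; rw [star_coeff]; exact hF _ (hp _)

theorem C_mem_coeffSubring {F : Subfield ℂ} {a : ℂ} (ha : a ∈ F) : C a ∈ coeffSubring F := by
  rw [mem_coeffSubring]
  intro k; rw [C_apply]; split_ifs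
  · exact ha
  · exact F.zero_mem

theorem T_mem_coeffSubring {F : Subfield ℂ} (n : ℤ) : (T n : ℂ[T;T⁻¹]) ∈ coeffSubring F := by
  rw [mem_coeffSubring]
  intro k; rw [T_apply]; split_ifs
  · exact F.one_mem
  · exact F.zero_mem

theorem invert_mem_coeffSubring {F : Subfield ℂ} {p : ℂ[T;T⁻¹]} (hp : p ∈ coeffSubring F) :
    invert p ∈ coeffSubring F := by
  rw [mem_coeffSubring] at *
  intro k; rw [invert_apply]; exact hp _

/-! ### Coefficient matrices -/

section CoefficientMatrices

variable {l m n : Type*}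

/-- A matrix of constants, regarded as a matrix of Laurent polynomials. -/
noncomputable def cmat (M : Matrix m n ℂ) : LMat m n := M.map C

/-- The coefficient matrix `Mₖ` of `M = ∑ Mₖ wᵏ`. -/
def cf (k : ℤ) (M : LMat m n) : Matrix m n ℂ := M.map fun p => p.coeff k

/-- Only exponents `≥ a` occur in `M`. -/
def LowerBound (a : ℤ) (M : LMat m n) : Prop := ∀ k < a, cf k M = 0

theorem ext_cf {M N : LMat m n} (h : ∀ k, cf k M = cf k N) : M = N := by
  ext i j k; exact congrFun (congrFun (h k) i) j

@[simp] theorem cf_add (k : ℤ) (M N : LMat m n) : cf k (M + N) = cf k M + cf k N := rfl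

@[simp] theorem cf_sub (k : ℤ) (M N : LMat m n) : cf k (M - N) = cf k M - cf k N := by
  ext i j; simp [cf]

@[simp] theorem cf_zero (k : ℤ) : cf k (0 : LMat m n) = 0 := rfl

theorem cf_conjTranspose (k : ℤ) (M : LMat m n) : cf k Mᴴ = (cf (-k) M)ᴴ := by
  ext i j; simp [cf, star_coeff]

theorem cf_invert (k : ℤ) (M : LMat m n) : cf k (M.map invert) = cf (-k) M := by
  ext i j; simp [cf]

theorem cf_negSubst (k : ℤ) (M : LMat m n) : cf k (M.map negSubst) = (-1 : ℂ) ^ k • cf k M := by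
  ext i j; simp [cf, negSubst_coeff]

theorem cf_T_smul (k a : ℤ) (M : LMat m n) :
    cf k ((T a : ℂ[T;T⁻¹]) • M) = cf (k - a) M := by
  ext i j; simp only [cf, Matrix.map_apply, Matrix.smul_apply, smul_eq_mul, coeff_T_mul]

theorem cf_cmat (k : ℤ) (M : Matrix m n ℂ) : cf k (cmat M) = if k = 0 then M else 0 := by
  ext i j
  by_cases h : k = 0 <;> simp [cf, cmat, h]

@[simp] theorem cf_zero_cmat (M : Matrix m n ℂ) : cf 0 (cmat M) = M := by simp [cf_cmat]

theorem cf_cmat_mul [Fintype m] (k : ℤ) (A : Matrix l m ℂ) (M : LMat m n) :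
    cf k (cmat A * M) = A * cf k M := by
  ext i j; simp [cf, cmat, Matrix.mul_apply, coeff_C_mul, Finsupp.finsetSum_apply]

theorem cf_mul_cmat [Fintype m] (k : ℤ) (M : LMat l m) (A : Matrix m n ℂ) :
    cf k (M * cmat A) = cf k M * A := by
  ext i j
  simp only [cf, cmat, Matrix.mul_apply, Matrix.map_apply, AddMonoidAlgebra.coeff_sum,
    Finsupp.finsetSum_apply]
  exact Finset.sum_congr rfl fun x _ => by rw [mul_comm, coeff_C_mul, mul_comm]

theorem cmat_mul [Fintype m] (A : Matrix l m ℂ) (B : Matrix m n ℂ) :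
    cmat (A * B) = cmat A * cmat B := Matrix.map_mul

theorem cmat_add (A B : Matrix m n ℂ) : cmat (A + B) = cmat A + cmat B :=
  Matrix.map_add _ (map_add C) _ _

@[simp] theorem cmat_one [DecidableEq m] : cmat (1 : Matrix m m ℂ) = 1 :=
  Matrix.map_one _ (map_zero C) (map_one C)

@[simp] theorem cmat_zero : cmat (0 : Matrix m n ℂ) = 0 :=
  Matrix.map_zero _ (map_zero C)

theorem cmat_conjTranspose (A : Matrix m n ℂ) : (cmat A)ᴴ = cmat Aᴴ := by
  ext i j; simp [cmat]

theorem cmat_invert (A : Matrix m n ℂ) : (cmat A).map invert = cmat A := by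
  ext i j; simp [cmat]

theorem cmat_negSubst (A : Matrix m n ℂ) : (cmat A).map negSubst = cmat A := by
  ext i j; simp [cmat, negSubst_C]

theorem cmat_injective : Function.Injective (cmat : Matrix m n ℂ → LMat m n) := fun A B h => by
  simpa using congrArg (cf 0) h

theorem cmat_entriesIn {F : Subfield ℂ} {A : Matrix m n ℂ} (hA : EntriesIn F.toSubring A) :
    EntriesIn (coeffSubring F) (cmat A) := fun i j => C_mem_coeffSubring (hA i j)

theorem cf_entriesIn {F : Subfield ℂ} {M : LMat m n} (hM : EntriesIn (coeffSubring F) M) (k : ℤ) :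
    EntriesIn F.toSubring (cf k M) := fun i j => mem_coeffSubring.1 (hM i j) k

/-- The lowest coefficient of a product is the product of the lowest coefficients. -/
theorem coeff_mul_lowest {p q : ℂ[T;T⁻¹]} {a b : ℤ} (hp : ∀ k < a, p.coeff k = 0)
    (hq : ∀ k < b, q.coeff k = 0) : (p * q).coeff (a + b) = p.coeff a * q.coeff b := by
  rw [AddMonoidAlgebra.coeff_mul_apply_left, Finsupp.sum, Finset.sum_eq_single a]
  · simp
  · intro k _ hk
    rcases lt_or_gt_of_ne hk with h | h
    · rw [hp k h, zero_mul]
    · rw [hq _ (by omega), mul_zero]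
  · intro h
    rw [Finsupp.notMem_support_iff.1 h, zero_mul]

theorem cf_mul_lowest [Fintype m] {M : LMat l m} {N : LMat m n} {a b : ℤ}
    (hM : LowerBound a M) (hN : LowerBound b N) : cf (a + b) (M * N) = cf a M * cf b N := by
  ext i j
  simp only [cf, Matrix.map_apply, Matrix.mul_apply, AddMonoidAlgebra.coeff_sum,
    Finsupp.finsetSum_apply]
  refine Finset.sum_congr rfl fun x _ => coeff_mul_lowest (fun k hk => ?_) (fun k hk => ?_)
  · exact congrFun (congrFun (hM k hk) i) x
  · exact congrFun (congrFun (hN k hk) x) j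

theorem LowerBound.mono {M : LMat m n} {a b : ℤ} (hM : LowerBound a M) (h : b ≤ a) :
    LowerBound b M := fun k hk => hM k (hk.trans_le h)

theorem LowerBound.mul [Fintype m] {M : LMat l m} {N : LMat m n} {a b : ℤ}
    (hM : LowerBound a M) (hN : LowerBound b N) : LowerBound (a + b) (M * N) := by
  intro k hk
  have h := cf_mul_lowest (hM.mono (b := k - b) (by omega)) hN
  rw [sub_add_cancel] at h
  rw [h, hM _ (by omega), Matrix.zero_mul]

theorem LowerBound.add {M N : LMat m n} {a : ℤ} (hM : LowerBound a M) (hN : LowerBound a N) :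
    LowerBound a (M + N) := fun k hk => by simp [hM k hk, hN k hk]

theorem LowerBound.sub {M N : LMat m n} {a : ℤ} (hM : LowerBound a M) (hN : LowerBound a N) :
    LowerBound a (M - N) := fun k hk => by simp [hM k hk, hN k hk]

theorem lowerBound_cmat (A : Matrix m n ℂ) : LowerBound 0 (cmat A) := fun k hk => by
  simp [cf_cmat, hk.ne]

theorem LowerBound.entry {M : LMat m n} {a : ℤ} (hM : LowerBound a M) (i : m) (j : n) {k : ℤ}
    (hk : k < a) : (M i j).coeff k = 0 := congrFun (congrFun (hM k hk) i) j

theorem exists_lowerBound [Finite m] [Finite n] (M : LMat m n) :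
    ∃ N : ℕ, LowerBound (-(N : ℤ)) M := by
  cases nonempty_fintype m
  cases nonempty_fintype n
  have h : ∀ i j, ∃ N : ℕ, ∀ k < -(N : ℤ), (M i j).coeff k = 0 := by
    intro i j
    obtain ⟨b, hb⟩ := (M i j).coeff.support.bddBelow
    refine ⟨b.natAbs, fun k hk => ?_⟩
    by_contra hne
    have := hb (Finsupp.mem_support_iff.2 hne)
    omega
  choose N hN using h
  refine ⟨∑ i, ∑ j, N i j, fun k hk => ?_⟩
  ext i j
  refine hN i j k (hk.trans_le ?_)
  have h1 : N i j ≤ ∑ j, N i j :=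
    Finset.single_le_sum (f := fun j => N i j) (by simp) (Finset.mem_univ j)
  have h2 : ∑ j, N i j ≤ ∑ i, ∑ j, N i j :=
    Finset.single_le_sum (f := fun i => ∑ j, N i j) (by simp) (Finset.mem_univ i)
  omega

/-- If `Q` has only exponents `≥ 0` and its constant coefficient has independent rows, then
multiplication by `Q` from the right creates no cancellation of the lowest coefficient. -/
theorem LowerBound.of_mul_right [Finite l] [Fintype m] {X : LMat l m} {Q : LMat m n}
    (hQ : LowerBound 0 Q) (hQ0 : ∀ c : m → ℂ, c ᵥ* cf 0 Q = 0 → c = 0)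
    (h : LowerBound 0 (X * Q)) : LowerBound 0 X := by
  obtain ⟨N, hN⟩ := exists_lowerBound X
  have key : ∀ j : ℕ, LowerBound (-(j : ℤ)) X → LowerBound 0 X := by
    intro j
    induction j with
    | zero => exact fun h => by simpa using h
    | succ j ih =>
      intro hj
      refine ih fun k hk => ?_
      obtain h1 | rfl : k < -((j + 1 : ℕ) : ℤ) ∨ k = -((j + 1 : ℕ) : ℤ) := by push_cast; omega
      · exact hj k h1
      · have h2 := cf_mul_lowest hj hQ
        rw [add_zero, h _ (by push_cast; omega)] at h2
        exact funext fun i => hQ0 _ (funext fun x => (congrFun (congrFun h2 i) x).symm)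
  exact key N hN

end CoefficientMatrices

/-! ### Projections and orthonormal families over a subfield -/

/-- Fitting's lemma for one matrix: write the characteristic polynomial as `xᵃ g` with `g(0) ≠ 0`
and `g / g(0)` as `1 - x h`. -/
theorem Matrix.exists_pow_mul_one_sub_mul_eq_zero {K n : Type*} [Field K] [Fintype n]
    [DecidableEq n] (X : Matrix n n K) : ∃ (a : ℕ) (Y : Matrix n n K), X ^ a * (1 - X * Y) = 0 := by
  obtain ⟨g, hg, hg0⟩ := Polynomial.exists_eq_pow_rootMultiplicity_mul_and_not_dvd X.charpoly
    X.charpoly_monic.ne_zero 0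
  rw [map_zero, sub_zero] at hg hg0
  rw [Polynomial.X_dvd_iff] at hg0
  refine ⟨X.charpoly.rootMultiplicity 0, -((g.coeff 0)⁻¹ • Polynomial.aeval X g.divX), ?_⟩
  have h1 : Polynomial.aeval X g = X * Polynomial.aeval X g.divX + algebraMap K _ (g.coeff 0) := by
    conv_lhs => rw [← Polynomial.X_mul_divX_add g]
    simp [-Polynomial.X_mul_divX_add]
  have h2 : 1 - X * -((g.coeff 0)⁻¹ • Polynomial.aeval X g.divX) =
      (g.coeff 0)⁻¹ • Polynomial.aeval X g := by
    rw [h1, smul_add, Algebra.algebraMap_eq_smul_one, smul_smul, inv_mul_cancel₀ hg0]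
    simp [add_comm]
  rw [h2, Matrix.mul_smul]
  have h3 := X.aeval_self_charpoly
  rw [hg, map_mul, map_pow, Polynomial.aeval_X] at h3
  rw [h3, smul_zero]

theorem EntriesIn.exists_map {F : Subfield ℂ} {m n : Type*} {M : Matrix m n ℂ}
    (hM : EntriesIn F.toSubring M) : ∃ M' : Matrix m n F, M'.map F.subtype = M :=
  ⟨Matrix.of fun i j => ⟨M i j, hM i j⟩, rfl⟩

theorem entriesIn_map {F : Subfield ℂ} {m n : Type*} (M : Matrix m n F) :
    EntriesIn F.toSubring (M.map F.subtype) := fun i j => (M i j).2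

section Projections

open scoped ComplexOrder

variable {m n : Type*} [Fintype m] [Fintype n] [DecidableEq n]

/-- The orthogonal projection onto the range of `Mᴴ`; its entries lie in every subfield that is
closed under conjugation and contains the entries of `M`. -/
theorem exists_range_projection {F : Subfield ℂ} (hF : ∀ x ∈ F, (starRingEnd ℂ) x ∈ F)
    {M : Matrix m n ℂ} (hM : EntriesIn F.toSubring M) :
    ∃ E : Matrix n n ℂ, EntriesIn F.toSubring E ∧ Eᴴ = E ∧ E * E = E ∧ M * E = M ∧
      ∃ Y : Matrix m n ℂ, E = Mᴴ * Y := by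
  have hX : EntriesIn F.toSubring (Mᴴ * M) := (hM.conjTranspose hF).mul hM
  obtain ⟨X', hX'⟩ := hX.exists_map
  obtain ⟨a, Y', hY'⟩ := X'.exists_pow_mul_one_sub_mul_eq_zero
  set Y : Matrix n n ℂ := Y'.map F.subtype with hY
  have h1 : (Mᴴ * M) ^ a * (1 - Mᴴ * M * Y) = 0 := by
    have := congrArg F.subtype.mapMatrix hY'
    rw [map_mul, map_pow, map_sub, map_mul, map_one, map_zero, RingHom.mapMatrix_apply,
      RingHom.mapMatrix_apply, hX'] at this
    exact this
  have hherm : (Mᴴ * M)ᴴ = Mᴴ * M := by simp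
  have h2 : ∀ b : ℕ, (Mᴴ * M) ^ (b + 1) * (1 - Mᴴ * M * Y) = 0 →
      M * (1 - Mᴴ * M * Y) = 0 := by
    intro b
    induction b with
    | zero =>
      intro h
      rw [zero_add, pow_one] at h
      exact (Matrix.conjTranspose_mul_self_mul_eq_zero _ _).1 h
    | succ b ih =>
      intro h
      refine ih ?_
      rw [pow_succ', Matrix.mul_assoc, ← Matrix.conjTranspose_mul_self_mul_eq_zero, hherm]
      rw [pow_succ', pow_succ'] at h
      simpa only [Matrix.mul_assoc] using h
  have h3 := h2 a (by rw [pow_succ', Matrix.mul_assoc, h1, Matrix.mul_zero])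
  have h4 : M * (Mᴴ * (M * Y)) = M := by
    rw [Matrix.mul_sub, Matrix.mul_one, sub_eq_zero] at h3
    rw [← Matrix.mul_assoc Mᴴ]; exact h3.symm
  set E := Mᴴ * (M * Y) with hE
  have h5 : Eᴴ * Mᴴ = Mᴴ := by rw [← Matrix.conjTranspose_mul, h4]
  have h6 : Eᴴ * E = E := by
    conv_lhs => rw [hE, ← Matrix.mul_assoc, h5]
  have h7 : Eᴴ = E := by
    conv_rhs => rw [← h6]
    conv_lhs => rw [← h6, Matrix.conjTranspose_mul, Matrix.conjTranspose_conjTranspose]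
  refine ⟨E, ?_, h7, ?_, h4, M * Y, rfl⟩
  · exact (hM.conjTranspose hF).mul (hM.mul (entriesIn_map _))
  · rw [h7] at h6; exact h6

end Projections

section Orthonormal

variable {ι n : Type*} [Fintype ι] [Fintype n] [DecidableEq ι] [DecidableEq n]

omit [DecidableEq ι] [DecidableEq n] in
/-- Fewer than `n` homogeneous linear equations over `F` have a nonzero solution over `F`. -/
theorem exists_vecMul_conjTranspose_eq_zero {F : Subfield ℂ} (hF : ∀ x ∈ F, (starRingEnd ℂ) x ∈ F)
    {W : Matrix ι n ℂ} (hW : EntriesIn F.toSubring W) (hcard : Fintype.card ι < Fintype.card n) :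
    ∃ x : n → ℂ, x ≠ 0 ∧ (∀ i, x i ∈ F) ∧ x ᵥ* Wᴴ = 0 := by
  obtain ⟨V, hV⟩ := (hW.conjTranspose hF).exists_map
  have h1 : LinearMap.ker V.vecMulLinear ≠ ⊥ := by
    refine LinearMap.ker_ne_bot_of_finrank_lt ?_
    simpa using hcard
  obtain ⟨y, hy, hy0⟩ := Submodule.exists_mem_ne_zero_of_ne_bot h1
  refine ⟨fun i => y i, ?_, fun i => (y i).2, ?_⟩
  · intro h
    refine hy0 (funext fun i => ?_)
    exact Subtype.ext (congrFun h i)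
  · rw [← hV]
    ext j
    have := congrArg F.subtype (congrFun (LinearMap.mem_ker.1 hy) j)
    simpa [Matrix.vecMul, dotProduct] using this

/-- From a nonzero vector of a space invariant under an involution `S` one gets a nonzero
eigenvector of `S` in that space. -/
theorem exists_eigenvector_of_involution {S : Matrix n n ℂ} (hS : S * S = 1) {x : n → ℂ}
    (hx : x ≠ 0) : ∃ θ : ℤˣ, x + (θ : ℤ) • x ᵥ* S ≠ 0 ∧
      (x + (θ : ℤ) • x ᵥ* S) ᵥ* S = (θ : ℤ) • (x + (θ : ℤ) • x ᵥ* S) := by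
  have h1 : x ᵥ* S ᵥ* S = x := by rw [Matrix.vecMul_vecMul, hS, Matrix.vecMul_one]
  by_cases h : x + x ᵥ* S = 0
  · refine ⟨-1, ?_, ?_⟩
    · intro h'
      apply hx
      have h2 : (2 : ℂ) • x = 0 := by
        have : (x + x ᵥ* S) + (x + ((-1 : ℤˣ) : ℤ) • x ᵥ* S) = 0 := by rw [h, h', add_zero]
        rw [← this, two_smul]; simp only [Units.val_neg, Units.val_one, neg_smul, one_smul]; abel
      simpa using h2
    · simp [Matrix.add_vecMul, Matrix.neg_vecMul, h1, add_comm]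
  · refine ⟨1, by simpa using h, ?_⟩
    simp [Matrix.add_vecMul, h1, add_comm]

omit [DecidableEq n] in
theorem exists_normalize {F : Subfield ℂ} (hF : ∀ x ∈ F, (starRingEnd ℂ) x ∈ F)
    (hsqrt : ∀ y : ℝ, 0 < y → (y : ℂ) ∈ F → ((√y : ℝ) : ℂ) ∈ F) {x : n → ℂ} (hx : x ≠ 0)
    (hxF : ∀ i, x i ∈ F) : ∃ a ∈ F, (a • x) ⬝ᵥ star (a • x) = 1 := by
  have h1 : x ⬝ᵥ star x = ((∑ i, ‖x i‖ ^ 2 : ℝ) : ℂ) := by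
    simp [dotProduct, Complex.mul_conj, Complex.normSq_eq_norm_sq]
  have h2 : 0 < ∑ i, ‖x i‖ ^ 2 := by
    obtain ⟨i, hi⟩ := Function.ne_iff.1 hx
    refine Finset.sum_pos' (fun _ _ => by positivity) ⟨i, Finset.mem_univ i, ?_⟩
    have : 0 < ‖x i‖ := norm_pos_iff.2 hi
    positivity
  set s := ∑ i, ‖x i‖ ^ 2
  have h3 : (s : ℂ) ∈ F := by
    rw [← h1]
    exact F.sum_mem fun i _ => F.mul_mem (hxF i) (hF _ (hxF i))
  refine ⟨((√s : ℝ) : ℂ)⁻¹, F.inv_mem (hsqrt s h2 h3), ?_⟩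
  rw [star_smul, smul_dotProduct, dotProduct_smul, h1]
  have h4 : ((√s : ℝ) : ℂ) ≠ 0 := by exact_mod_cast (Real.sqrt_pos.2 h2).ne'
  have h5 : ((√s : ℝ) : ℂ) * ((√s : ℝ) : ℂ) = s := by
    rw [← Complex.ofReal_mul, Real.mul_self_sqrt h2.le]
  simp only [star_inv₀, smul_eq_mul, Complex.star_def, Complex.conj_ofReal]
  rw [← h5]; field_simp

omit [DecidableEq ι] in
/-- Gram–Schmidt over `F`, respecting two commuting Hermitian involutions `D` and `S`: the rows of
`P` are completed by common eigenvectors of `D` and `S`. -/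
theorem exists_orthonormal_eigenvectors {F : Subfield ℂ} (hF : ∀ x ∈ F, (starRingEnd ℂ) x ∈ F)
    (hsqrt : ∀ y : ℝ, 0 < y → (y : ℂ) ∈ F → ((√y : ℝ) : ℂ) ∈ F)
    {P : Matrix ι n ℂ} (hP : EntriesIn F.toSubring P)
    {D S : Matrix n n ℂ} (hD : EntriesIn F.toSubring D) (hS : EntriesIn F.toSubring S)
    (hDH : Dᴴ = D) (hSH : Sᴴ = S) (hDD : D * D = 1) (hSS : S * S = 1) (hDS : D * S = S * D)
    (hPD : ∃ Z : Matrix ι ι ℂ, D * Pᴴ = Pᴴ * Z) (hPS : ∃ Z : Matrix ι ι ℂ, S * Pᴴ = Pᴴ * Z) (m : ℕ)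
    (hm : Fintype.card ι + m ≤ Fintype.card n) :
    ∃ (u : Fin m → n → ℂ) (δ θ : Fin m → ℤˣ), (∀ i j, u i j ∈ F) ∧
      (∀ i j, u i ⬝ᵥ star (u j) = if i = j then 1 else 0) ∧
      (∀ i, u i ᵥ* Pᴴ = 0) ∧ (∀ i, u i ᵥ* D = (δ i : ℤ) • u i) ∧
      ∀ i, u i ᵥ* S = (θ i : ℤ) • u i := by
  induction m with
  | zero => exact ⟨0, 1, 1, fun i => i.elim0, fun i => i.elim0, fun i => i.elim0,
      fun i => i.elim0, fun i => i.elim0⟩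
  | succ m ih =>
    obtain ⟨u, δ, θ, huF, huu, huP, huD, huS⟩ := ih (by omega)
    -- a nonzero vector orthogonal to all rows found so far
    obtain ⟨x, hx0, hxF, hx⟩ := exists_vecMul_conjTranspose_eq_zero hF
      (W := Matrix.fromRows P (Matrix.of u)) (fun i j => by
        cases i with
        | inl i => exact hP i j
        | inr i => exact huF i j) (by simp; omega)
    have hxP : x ᵥ* Pᴴ = 0 := funext fun i => congrFun hx (Sum.inl i)
    have hxU : ∀ i, x ⬝ᵥ star (u i) = 0 := fun i => congrFun hx (Sum.inr i)
    -- the orthogonal complement is invariant under an involution that has the rows as eigenvectors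
    have inv : ∀ {A : Matrix n n ℂ} {α : Fin m → ℤˣ}, Aᴴ = A →
        (∃ Z : Matrix ι ι ℂ, A * Pᴴ = Pᴴ * Z) →
        EntriesIn F.toSubring A → (∀ i, u i ᵥ* A = (α i : ℤ) • u i) → ∀ (s : ℤˣ) (y : n → ℂ),
        ((∀ i, y i ∈ F) ∧ y ᵥ* Pᴴ = 0 ∧ ∀ i, y ⬝ᵥ star (u i) = 0) →
        ((∀ i, (y + (s : ℤ) • y ᵥ* A) i ∈ F) ∧ (y + (s : ℤ) • y ᵥ* A) ᵥ* Pᴴ = 0 ∧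
          ∀ i, (y + (s : ℤ) • y ᵥ* A) ⬝ᵥ star (u i) = 0) := by
      rintro A α hA ⟨Z, hZ⟩ hAF hUA s y ⟨hy1, hy2, hy3⟩
      refine ⟨fun i => ?_, ?_, fun i => ?_⟩
      · refine F.add_mem (hy1 i) (F.zsmul_mem ?_ _)
        exact F.sum_mem fun k _ => F.mul_mem (hy1 k) (hAF k i)
      · rw [Matrix.add_vecMul, hy2, Matrix.smul_vecMul, Matrix.vecMul_vecMul, hZ,
          ← Matrix.vecMul_vecMul, hy2, Matrix.zero_vecMul, smul_zero, add_zero]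
      · rw [add_dotProduct, hy3, smul_dotProduct, ← Matrix.dotProduct_mulVec]
        have : A *ᵥ star (u i) = (α i : ℤ) • star (u i) := by
          rw [← hA, ← Matrix.star_vecMul, hUA, star_smul]; simp
        rw [this, dotProduct_smul, hy3]; simp
    obtain ⟨d, hd0, hd⟩ := exists_eigenvector_of_involution hDD hx0
    have h1 := inv hDH hPD hD huD d x ⟨hxF, hxP, hxU⟩
    set y := x + (d : ℤ) • x ᵥ* D
    clear_value y
    obtain ⟨s, hs0, hs⟩ := exists_eigenvector_of_involution hSS hd0
    have h2 := inv hSH hPS hS huS s y h1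
    have h3 : (y + (s : ℤ) • y ᵥ* S) ᵥ* D = (d : ℤ) • (y + (s : ℤ) • y ᵥ* S) := by
      rw [Matrix.add_vecMul, Matrix.smul_vecMul, Matrix.vecMul_vecMul, ← hDS,
        ← Matrix.vecMul_vecMul, hd, Matrix.smul_vecMul, smul_add, smul_comm (s : ℤ)]
    set v := y + (s : ℤ) • y ᵥ* S
    obtain ⟨a, haF, ha⟩ := exists_normalize hF hsqrt hs0 h2.1
    have e1 : ∀ i, (a • v) ⬝ᵥ star (u i) = 0 := fun i => by
      rw [smul_dotProduct, h2.2.2, smul_zero]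
    refine ⟨Fin.snoc u (a • v), Fin.snoc δ d, Fin.snoc θ s, ?_, ?_, ?_, ?_, ?_⟩
    · refine fun i => Fin.lastCases ?_ (fun i => ?_) i
      · simpa using fun j => F.mul_mem haF (h2.1 j)
      · simpa using huF i
    · refine fun i j => Fin.lastCases ?_ (fun i => ?_) i <;>
        refine Fin.lastCases ?_ (fun j => ?_) j
      · simp only [Fin.snoc_last, ha, if_true]
      · simp only [Fin.snoc_last, Fin.snoc_castSucc, e1, (Fin.castSucc_lt_last j).ne', if_false]
      · have e2 : u i ⬝ᵥ star (a • v) = star ((a • v) ⬝ᵥ star (u i)) := by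
          simp [dotProduct, mul_comm]
        rw [Fin.snoc_last, Fin.snoc_castSucc, if_neg (Fin.castSucc_lt_last i).ne, e2, e1, star_zero]
      · simp only [Fin.snoc_castSucc, huu, Fin.castSucc_inj]
    · refine fun i => Fin.lastCases ?_ (fun i => ?_) i
      · rw [Fin.snoc_last, Matrix.smul_vecMul, h2.2.1, smul_zero]
      · rw [Fin.snoc_castSucc, huP]
    · refine fun i => Fin.lastCases ?_ (fun i => ?_) i
      · rw [Fin.snoc_last, Fin.snoc_last, Matrix.smul_vecMul, h3, smul_comm]
      · rw [Fin.snoc_castSucc, Fin.snoc_castSucc, huD]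
    · refine fun i => Fin.lastCases ?_ (fun i => ?_) i
      · rw [Fin.snoc_last, Fin.snoc_last, Matrix.smul_vecMul, hs, smul_comm]
      · rw [Fin.snoc_castSucc, Fin.snoc_castSucc, huS]

omit [DecidableEq ι] in
/-- The matrix form of `exists_orthonormal_eigenvectors`, with the rows indexed by a given type. -/
theorem exists_unitary_eigenrows {κ : Type*} [Fintype κ] [DecidableEq κ] {F : Subfield ℂ}
    (hF : ∀ x ∈ F, (starRingEnd ℂ) x ∈ F)
    (hsqrt : ∀ y : ℝ, 0 < y → (y : ℂ) ∈ F → ((√y : ℝ) : ℂ) ∈ F)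
    {P : Matrix ι n ℂ} (hP : EntriesIn F.toSubring P)
    {D S : Matrix n n ℂ} (hD : EntriesIn F.toSubring D) (hS : EntriesIn F.toSubring S)
    (hDH : Dᴴ = D) (hSH : Sᴴ = S) (hDD : D * D = 1) (hSS : S * S = 1) (hDS : D * S = S * D)
    (hPD : ∃ Z : Matrix ι ι ℂ, D * Pᴴ = Pᴴ * Z) (hPS : ∃ Z : Matrix ι ι ℂ, S * Pᴴ = Pᴴ * Z)
    (hcard : Fintype.card ι + Fintype.card κ = Fintype.card n) :
    ∃ (U : Matrix κ n ℂ) (δ θ : κ → ℤˣ), EntriesIn F.toSubring U ∧ U * Uᴴ = 1 ∧ U * Pᴴ = 0 ∧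
      U * D = Matrix.diagonal (fun i => ((δ i : ℤ) : ℂ)) * U ∧
      U * S = Matrix.diagonal (fun i => ((θ i : ℤ) : ℂ)) * U := by
  obtain ⟨u, δ, θ, huF, huu, huP, huD, huS⟩ := exists_orthonormal_eigenvectors hF hsqrt hP hD hS
    hDH hSH hDD hSS hDS hPD hPS _ hcard.le
  have e := Fintype.equivFin κ
  refine ⟨Matrix.of fun i => u (e i), fun i => δ (e i), fun i => θ (e i), fun i => huF _, ?_, ?_,
    ?_, ?_⟩
  · ext i j
    rw [Matrix.one_apply]
    exact (huu (e i) (e j)).trans (by simp)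
  · exact funext fun i => huP (e i)
  · ext i j
    rw [Matrix.diagonal_mul]
    exact (congrFun (huD (e i)) j).trans (by simp)
  · ext i j
    rw [Matrix.diagonal_mul]
    exact (congrFun (huS (e i)) j).trans (by simp)

end Orthonormal

/-- Orthonormal rows `P` and orthonormal rows `Q` orthogonal to them, together as many as there are
columns, form a unitary matrix. -/
theorem conjTranspose_mul_add_eq_one {R ι κ n : Type*} [CommRing R] [StarRing R] [Fintype ι]
    [Fintype κ] [Fintype n] [DecidableEq ι] [DecidableEq κ] [DecidableEq n] {P : Matrix ι n R}
    {Q : Matrix κ n R} (hP : P * Pᴴ = 1) (hQ : Q * Qᴴ = 1) (hQP : Q * Pᴴ = 0)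
    (hcard : Fintype.card ι + Fintype.card κ = Fintype.card n) : Pᴴ * P + Qᴴ * Q = 1 := by
  have e : n ≃ ι ⊕ κ := Fintype.equivOfCardEq (by simp [hcard])
  have hPQ : P * Qᴴ = 0 := by
    rw [← Matrix.conjTranspose_conjTranspose (P * Qᴴ), Matrix.conjTranspose_mul,
      Matrix.conjTranspose_conjTranspose, hQP, Matrix.conjTranspose_zero]
  have h1 : Matrix.fromRows P Q * (Matrix.fromRows P Q)ᴴ = 1 := by
    rw [Matrix.conjTranspose_fromRows_eq_fromCols_conjTranspose, Matrix.fromRows_mul_fromCols, hP,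
      hQ, hQP, hPQ, Matrix.fromBlocks_one]
  rw [Matrix.mul_eq_one_comm_of_equiv e.symm] at h1
  rwa [Matrix.conjTranspose_fromRows_eq_fromCols_conjTranspose, Matrix.fromCols_mul_fromRows] at h1

/-! ### Paraunitary factors of degree one -/

section DegreeOne

variable {l n : Type*} [Fintype n] [DecidableEq n]

/-- The factor `I - E + w E`, paraunitary if `E` is an orthogonal projection. -/
noncomputable def bmat (E : Matrix n n ℂ) : LMat n n :=
  cmat (1 - E) + (T 1 : ℂ[T;T⁻¹]) • cmat E

omit [Fintype n] in
theorem bmat_conjTranspose {E : Matrix n n ℂ} (hE : Eᴴ = E) :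
    (bmat E)ᴴ = cmat (1 - E) + (T (-1) : ℂ[T;T⁻¹]) • cmat E := by
  rw [bmat, Matrix.conjTranspose_add, Matrix.conjTranspose_smul, cmat_conjTranspose,
    cmat_conjTranspose, hE, Matrix.conjTranspose_sub, Matrix.conjTranspose_one, hE, star_T]

theorem bmat_mul_conjTranspose {E : Matrix n n ℂ} (hE : Eᴴ = E) (hEE : E * E = E) :
    bmat E * (bmat E)ᴴ = 1 := by
  have h1 : (1 - E) * E = 0 := by rw [sub_mul, one_mul, hEE, sub_self]
  have h2 : E * (1 - E) = 0 := by rw [mul_sub, mul_one, hEE, sub_self]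
  have h3 : (1 - E) * (1 - E) = 1 - E := by rw [mul_sub, h1, mul_one, sub_zero]
  rw [bmat_conjTranspose hE, bmat, add_mul, mul_add, mul_add, Matrix.smul_mul, Matrix.smul_mul,
    Matrix.mul_smul, Matrix.mul_smul, ← cmat_mul, ← cmat_mul, ← cmat_mul, ← cmat_mul, h1, h2, h3,
    hEE, cmat_zero, smul_zero, smul_zero, add_zero, zero_add, smul_smul, ← T_add, add_neg_cancel,
    T_zero, one_smul, ← cmat_add, sub_add_cancel, cmat_one]

theorem conjTranspose_mul_bmat {E : Matrix n n ℂ} (hE : Eᴴ = E) (hEE : E * E = E) :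
    (bmat E)ᴴ * bmat E = 1 := mul_eq_one_comm.1 (bmat_mul_conjTranspose hE hEE)

omit [Fintype n] in
theorem bmat_invert {E : Matrix n n ℂ} (hE : Eᴴ = E) : (bmat E).map invert = (bmat E)ᴴ := by
  rw [bmat_conjTranspose hE]
  ext i j : 2
  simp [bmat, cmat]

theorem bmat_negSubst {E : Matrix n n ℂ} (hEE : E * E = E) :
    (bmat E).map negSubst = cmat (1 - (E + E)) * bmat E := by
  have h1 : (1 - (E + E)) * (1 - E) = 1 - E := by
    simp only [sub_mul, mul_sub, add_mul, one_mul, mul_one, hEE]; abel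
  have h2 : (1 - (E + E)) * E = -E := by
    simp only [sub_mul, add_mul, one_mul, hEE]; abel
  have h3 : (T 1 : ℂ[T;T⁻¹]) • cmat (-E) = -((T 1 : ℂ[T;T⁻¹]) • cmat E) := by
    rw [← smul_neg]; congr 1; ext i j : 2; simp [cmat]
  rw [bmat, mul_add, Matrix.mul_smul, ← cmat_mul, ← cmat_mul, h1, h2, h3]
  ext i j : 2
  simp [cmat, negSubst_C, negSubst_T, -T_mul]

theorem cf_mul_bmat_conjTranspose {E : Matrix n n ℂ} (hE : Eᴴ = E) (k : ℤ) (M : LMat l n) :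
    cf k (M * (bmat E)ᴴ) = cf k M * (1 - E) + cf (k + 1) M * E := by
  rw [bmat_conjTranspose hE, Matrix.mul_add, Matrix.mul_smul, cf_add, cf_T_smul, cf_mul_cmat,
    cf_mul_cmat, sub_neg_eq_add]

theorem cf_bmat_conjTranspose_mul {E : Matrix n n ℂ} (hE : Eᴴ = E) (k : ℤ) (M : LMat n l) :
    cf k ((bmat E)ᴴ * M) = (1 - E) * cf k M + E * cf (k + 1) M := by
  rw [bmat_conjTranspose hE, Matrix.add_mul, Matrix.smul_mul, cf_add, cf_T_smul, cf_cmat_mul,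
    cf_cmat_mul, sub_neg_eq_add]

omit [Fintype n] in
theorem cf_zero_bmat (E : Matrix n n ℂ) : cf 0 (bmat E) = 1 - E := by
  rw [bmat, cf_add, cf_T_smul, cf_cmat, cf_cmat]; simp

omit [Fintype n] in
theorem lowerBound_bmat (E : Matrix n n ℂ) : LowerBound 0 (bmat E) := fun k hk => by
  rw [bmat, cf_add, cf_T_smul, cf_cmat, cf_cmat, if_neg hk.ne, if_neg (by omega), add_zero]

omit [Fintype n] in
theorem bmat_entriesIn {F : Subfield ℂ} {E : Matrix n n ℂ} (hE : EntriesIn F.toSubring E) :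
    EntriesIn (coeffSubring F) (bmat E) :=
  (cmat_entriesIn (EntriesIn.one.sub hE)).add fun i j =>
    Subring.mul_mem _ (T_mem_coeffSubring 1) (cmat_entriesIn hE i j)

omit [Fintype n] in
theorem cf_one (k : ℤ) : cf k (1 : LMat n n) = if k = 0 then 1 else 0 := by
  rw [← cmat_one, cf_cmat]

end DegreeOne

/-! ### Completion without symmetry -/

section Completion

variable {ι κ n : Type*} [Fintype ι] [Fintype κ] [Fintype n] [DecidableEq ι] [DecidableEq κ]
  [DecidableEq n]

omit [Fintype ι] [Fintype n] [DecidableEq ι] [DecidableEq n] in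
theorem lowerBound_conjTranspose {M : LMat ι n} {N : ℤ} (h : ∀ k > N, cf k M = 0) :
    LowerBound (-N) Mᴴ := fun k hk => by
  rw [cf_conjTranspose, h _ (by omega), Matrix.conjTranspose_zero]

theorem mul_conjTranspose_eq_zero {P : LMat ι n} {Q : LMat κ n} (hQ : Q * Qᴴ = 1)
    (h : Pᴴ * P + Qᴴ * Q = 1) (hP : P * Pᴴ = 1) : Q * Pᴴ = 0 := by
  have h1 : (Pᴴ * P + Qᴴ * Q) * Pᴴ = Pᴴ := by rw [h, Matrix.one_mul]
  rw [Matrix.add_mul, Matrix.mul_assoc, hP, Matrix.mul_one, add_eq_left, Matrix.mul_assoc] at h1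
  calc Q * Pᴴ = Q * Qᴴ * (Q * Pᴴ) := by rw [hQ, Matrix.one_mul]
    _ = Q * (Qᴴ * (Q * Pᴴ)) := Matrix.mul_assoc _ _ _
    _ = 0 := by rw [h1, Matrix.mul_zero]

/-- Completion of `P = P₀ + P₁ w + ⋯ + P_N w^N` with orthonormal rows, by induction on `N`: with
the projection `E` onto the range of `P_Nᴴ`, the product `P (I - E + w⁻¹ E)` has degree `N - 1`.
The completing rows `Q` are those of lowest possible degree, in the sense that `Q(0)` has
independent rows; this makes the space they span canonical. -/
theorem exists_completion {F : Subfield ℂ} (hF : ∀ x ∈ F, (starRingEnd ℂ) x ∈ F)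
    (hsqrt : ∀ y : ℝ, 0 < y → (y : ℂ) ∈ F → ((√y : ℝ) : ℂ) ∈ F)
    (hcard : Fintype.card ι + Fintype.card κ = Fintype.card n) (N : ℕ) (P : LMat ι n)
    (hPF : EntriesIn (coeffSubring F) P) (hP : P * Pᴴ = 1) (hP0 : LowerBound 0 P)
    (hPN : ∀ k > (N : ℤ), cf k P = 0) :
    ∃ Q : LMat κ n, EntriesIn (coeffSubring F) Q ∧ Q * Qᴴ = 1 ∧ Pᴴ * P + Qᴴ * Q = 1 ∧
      LowerBound 0 Q ∧ ∀ c : κ → ℂ, c ᵥ* cf 0 Q = 0 → c = 0 := by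
  induction N generalizing P with
  | zero =>
    have hconst : P = cmat (cf 0 P) := ext_cf fun k => by
      rw [cf_cmat]
      split_ifs with h
      · rw [h]
      · rcases lt_or_gt_of_ne h with h | h
        · exact hP0 k h
        · exact hPN k (by simpa using h)
    obtain ⟨U, -, -, hUF, hUU, hUP, -, -⟩ := exists_unitary_eigenrows (κ := κ) hF hsqrt
      (cf_entriesIn hPF 0) (D := 1) (S := 1) EntriesIn.one EntriesIn.one (by simp) (by simp)
      (by simp) (by simp) rfl ⟨1, by simp⟩ ⟨1, by simp⟩ hcard
    have hQ : cmat U * (cmat U)ᴴ = 1 := by rw [cmat_conjTranspose, ← cmat_mul, hUU, cmat_one]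
    refine ⟨cmat U, cmat_entriesIn hUF, hQ, ?_, lowerBound_cmat U, fun c hc => ?_⟩
    · refine conjTranspose_mul_add_eq_one hP hQ ?_ hcard
      rw [hconst, cmat_conjTranspose, ← cmat_mul, hUP, cmat_zero]
    · rw [cf_zero_cmat] at hc
      rw [← Matrix.vecMul_one c, ← hUU, ← Matrix.vecMul_vecMul, hc, Matrix.zero_vecMul]
  | succ N ih =>
    obtain ⟨E, hEF, hEH, hEE, hE, Y, hY⟩ :=
      exists_range_projection hF (cf_entriesIn hPF ((N + 1 : ℕ) : ℤ))
    set L := cf ((N + 1 : ℕ) : ℤ) P with hL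
    have h0 : cf 0 P * E = 0 := by
      have h1 := cf_mul_lowest hP0 (lowerBound_conjTranspose hPN)
      rw [hP, cf_one, if_neg (by push_cast; omega), cf_conjTranspose, neg_neg, ← hL] at h1
      rw [hY, ← Matrix.mul_assoc, ← h1, Matrix.zero_mul]
    have hBB := conjTranspose_mul_bmat hEH hEE
    have hBB' := bmat_mul_conjTranspose hEH hEE
    have hBF := bmat_entriesIn hEF
    have hP' : P * (bmat E)ᴴ * (P * (bmat E)ᴴ)ᴴ = 1 := by
      rw [Matrix.conjTranspose_mul, Matrix.conjTranspose_conjTranspose, Matrix.mul_assoc,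
        ← Matrix.mul_assoc _ _ Pᴴ, hBB, Matrix.one_mul, hP]
    have hPN' : ∀ k > (N : ℤ), cf k (P * (bmat E)ᴴ) = 0 := fun k hk => by
      rw [cf_mul_bmat_conjTranspose hEH, hPN (k + 1) (by push_cast; omega), Matrix.zero_mul,
        add_zero]
      rcases (show k = ((N + 1 : ℕ) : ℤ) ∨ k > ((N + 1 : ℕ) : ℤ) by push_cast; omega) with h | h
      · rw [h, ← hL, Matrix.mul_sub, Matrix.mul_one, hE, sub_self]
      · rw [hPN k h, Matrix.zero_mul]
    obtain ⟨Q, hQF, hQ, hPQ, hQ0, hinj⟩ := ih (P * (bmat E)ᴴ)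
      (hPF.mul (hBF.conjTranspose fun x => star_mem_coeffSubring hF)) hP'
      (fun k hk => by
        rw [cf_mul_bmat_conjTranspose hEH, hP0 k hk, Matrix.zero_mul, zero_add]
        rcases (show k + 1 < 0 ∨ k + 1 = 0 by omega) with h | h
        · rw [hP0 _ h, Matrix.zero_mul]
        · rw [h, h0]) hPN'
    refine ⟨Q * bmat E, hQF.mul hBF, ?_, ?_, ?_, ?_⟩
    · rw [Matrix.conjTranspose_mul, Matrix.mul_assoc, ← Matrix.mul_assoc _ _ Qᴴ, hBB',
        Matrix.one_mul, hQ]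
    · have h1 : (bmat E)ᴴ * ((P * (bmat E)ᴴ)ᴴ * (P * (bmat E)ᴴ) + Qᴴ * Q) * bmat E = 1 := by
        rw [hPQ, Matrix.mul_one, hBB]
      rw [← h1, Matrix.conjTranspose_mul P, Matrix.conjTranspose_conjTranspose,
        Matrix.conjTranspose_mul Q, Matrix.mul_add, Matrix.add_mul]
      have h2 : (bmat E)ᴴ * (bmat E * Pᴴ * (P * (bmat E)ᴴ)) * bmat E =
          ((bmat E)ᴴ * bmat E) * (Pᴴ * P) * ((bmat E)ᴴ * bmat E) := by
        simp only [Matrix.mul_assoc]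
      rw [h2, hBB, Matrix.one_mul, Matrix.mul_one]
      simp only [Matrix.mul_assoc]
    · simpa using hQ0.mul (lowerBound_bmat E)
    · intro c hc
      have h1 := cf_mul_lowest hQ0 (lowerBound_bmat E)
      rw [add_zero, cf_zero_bmat] at h1
      rw [h1, ← Matrix.vecMul_vecMul, Matrix.vecMul_sub, Matrix.vecMul_one, sub_eq_zero] at hc
      refine hinj c ?_
      -- the lowest coefficient of `Q P'ᴴ = 0`, where `P'` has the coefficient `P'_N E = P_{N+1}`
      have h2 := cf_mul_lowest hQ0 (lowerBound_conjTranspose hPN')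
      rw [mul_conjTranspose_eq_zero hQ hPQ hP', cf_zero, cf_conjTranspose, neg_neg] at h2
      have h3 : cf N (P * (bmat E)ᴴ) * E = L := by
        rw [cf_mul_bmat_conjTranspose hEH, Matrix.add_mul, Matrix.mul_assoc, Matrix.mul_assoc,
          hEE, Matrix.sub_mul, hEE, Matrix.one_mul, sub_self, Matrix.mul_zero, zero_add,
          show ((N : ℤ) + 1) = ((N + 1 : ℕ) : ℤ) by push_cast; ring, ← hL, hE]
      have h3' : E * (cf N (P * (bmat E)ᴴ))ᴴ = Lᴴ := by
        rw [← h3, Matrix.conjTranspose_mul, hEH]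
      have h4 : (c ᵥ* cf 0 Q) ᵥ* Lᴴ = 0 := by
        rw [← h3', ← Matrix.vecMul_vecMul, ← hc, Matrix.vecMul_vecMul, ← h2, Matrix.vecMul_zero]
      rw [hc, hY, ← Matrix.vecMul_vecMul, h4, Matrix.zero_vecMul]

omit [DecidableEq ι] [DecidableEq κ] in
/-- Rows `R` orthogonal to `P` and without negative exponents are combinations, with coefficients
without negative exponents, of the canonical rows `Q`. -/
theorem eq_mul_of_completion {P : LMat ι n} {Q R : LMat κ n} (hPQ : Pᴴ * P + Qᴴ * Q = 1)
    (hQ0 : LowerBound 0 Q) (hinj : ∀ c : κ → ℂ, c ᵥ* cf 0 Q = 0 → c = 0) (hR : R * Pᴴ = 0)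
    (hR0 : LowerBound 0 R) : R * Qᴴ * Q = R ∧ LowerBound 0 (R * Qᴴ) := by
  have h1 : R * Qᴴ * Q = R := by
    have h2 : R * (Pᴴ * P + Qᴴ * Q) = R := by rw [hPQ, Matrix.mul_one]
    rwa [Matrix.mul_add, ← Matrix.mul_assoc, hR, Matrix.zero_mul, zero_add,
      ← Matrix.mul_assoc] at h2
  exact ⟨h1, LowerBound.of_mul_right hQ0 hinj (by rwa [h1])⟩

end Completion

/-! ### Symmetric factorization of a graded reflection -/

section Reflection

variable {n : Type*} [Fintype n] [DecidableEq n]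

/-- The matrix `G` by which the reflection `w ↦ 1/w` acts on the basis of a reflection invariant
module of rows, together with the matrix `S` by which the grading `w ↦ -w` acts on that basis: `G`
is polynomial in `w` and paraunitary, its coefficients are Hermitian, and `G(-w) = S G(w) S` with a
Hermitian involution `S`. -/
structure IsGradedReflection (F : Subfield ℂ) (G : LMat n n) (S : Matrix n n ℂ) : Prop where
  entries : EntriesIn (coeffSubring F) G
  lowerBound : LowerBound 0 G
  paraunitary : G * Gᴴ = 1
  invert_eq : G.map invert = Gᴴ
  negSubst_eq : G.map negSubst = cmat S * G * cmat S
  grading_entries : EntriesIn F.toSubring S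
  grading_hermitian : Sᴴ = S
  grading_sq : S * S = 1

theorem map_mul_invert {l m n : Type*} [Fintype m] (M : LMat l m) (N : LMat m n) :
    (M * N).map invert = M.map invert * N.map invert := Matrix.map_mul (f := invert)

theorem map_mul_negSubst {l m n : Type*} [Fintype m] (M : LMat l m) (N : LMat m n) :
    (M * N).map negSubst = M.map negSubst * N.map negSubst := Matrix.map_mul

theorem map_invert_invert {m n : Type*} (M : LMat m n) : (M.map invert).map invert = M := by
  ext i j k; simp

theorem conjTranspose_map_negSubst {m n : Type*} (M : LMat m n) :
    Mᴴ.map negSubst = (M.map negSubst)ᴴ := by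
  ext i j : 2; simp [negSubst_star]

theorem conjTranspose_map_invert {m n : Type*} (M : LMat m n) :
    Mᴴ.map invert = (M.map invert)ᴴ := by
  ext i j : 2; simp [invert_star]

theorem cmat_mul_bmat_comm {X E : Matrix n n ℂ} (h : X * E = E * X) :
    cmat X * bmat E = bmat E * cmat X := by
  rw [bmat, mul_add, add_mul, Matrix.mul_smul, Matrix.smul_mul, ← cmat_mul, ← cmat_mul,
    ← cmat_mul, ← cmat_mul, mul_sub, sub_mul, h, mul_one, one_mul]

theorem cmat_mul_bmat_conjTranspose_comm {X E : Matrix n n ℂ} (hE : Eᴴ = E) (h : X * E = E * X) :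
    cmat X * (bmat E)ᴴ = (bmat E)ᴴ * cmat X := by
  rw [bmat_conjTranspose hE, mul_add, add_mul, Matrix.mul_smul, Matrix.smul_mul, ← cmat_mul,
    ← cmat_mul, ← cmat_mul, ← cmat_mul, mul_sub, sub_mul, h, mul_one, one_mul]

namespace IsGradedReflection

variable {F : Subfield ℂ} {G : LMat n n} {S E : Matrix n n ℂ}

theorem cf_hermitian (h : IsGradedReflection F G S) (k : ℤ) : (cf k G)ᴴ = cf k G := by
  have h1 := congrArg (cf (-k)) h.invert_eq
  rw [cf_invert, cf_conjTranspose, neg_neg] at h1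
  exact h1.symm

theorem cf_grading (h : IsGradedReflection F G S) (k : ℤ) :
    (-1 : ℂ) ^ k • cf k G = S * cf k G * S := by
  have h1 := congrArg (cf k) h.negSubst_eq
  rwa [cf_negSubst, cf_mul_cmat, cf_cmat_mul] at h1

/-- The product of the lowest and the highest coefficient vanishes. -/
theorem cf_zero_mul_top (h : IsGradedReflection F G S) {N : ℤ} (hN : 0 < N)
    (hG : ∀ k > N, cf k G = 0) : cf 0 G * cf N G = 0 := by
  have h1 := cf_mul_lowest h.lowerBound (lowerBound_conjTranspose hG)
  rw [h.paraunitary, cf_one, if_neg (by omega), cf_conjTranspose, neg_neg, h.cf_hermitian] at h1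
  exact h1.symm

theorem cf_reduce (hE : Eᴴ = E) (k : ℤ) :
    cf k ((bmat E)ᴴ * G * (bmat E)ᴴ) = ((1 - E) * cf k G + E * cf (k + 1) G) * (1 - E) +
      ((1 - E) * cf (k + 1) G + E * cf (k + 1 + 1) G) * E := by
  rw [cf_mul_bmat_conjTranspose hE, cf_bmat_conjTranspose_mul hE, cf_bmat_conjTranspose_mul hE]

/-- Let `E` project onto a space on which `G(0)` vanishes and that is even or odd for the grading.
Then `E G₁ E = 0` as `G₁` is odd, and `w⁻¹` may be split off on both sides. -/
theorem reduce (h : IsGradedReflection F G S) (hF : ∀ x ∈ F, (starRingEnd ℂ) x ∈ F)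
    (hEF : EntriesIn F.toSubring E) (hE : Eᴴ = E) (hEE : E * E = E) (h0 : cf 0 G * E = 0)
    (hSE : S * E = E ∨ S * E = -E) :
    IsGradedReflection F ((bmat E)ᴴ * G * (bmat E)ᴴ) (S * (1 - (E + E))) := by
  have hES : E * S = (S * E)ᴴ := by rw [Matrix.conjTranspose_mul, hE, h.grading_hermitian]
  have hcomm : E * S = S * E := by
    rcases hSE with h | h <;> rw [hES, h] <;> simp [hE]
  have h0' : E * cf 0 G = 0 := by
    rw [← hE, ← h.cf_hermitian, ← Matrix.conjTranspose_mul, h0, Matrix.conjTranspose_zero]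
  have h1 : E * cf 1 G * E = 0 := by
    have h2 : E * (S * cf 1 G * S) * E = E * cf 1 G * E := by
      have : E * (S * cf 1 G * S) * E = (E * S) * cf 1 G * (S * E) := by
        simp only [Matrix.mul_assoc]
      rw [this, hcomm]
      rcases hSE with h | h
      · rw [h]
      · rw [h]; simp
    rw [← h.cf_grading] at h2
    simp only [zpow_one, neg_smul, one_smul, Matrix.mul_neg, Matrix.neg_mul] at h2
    have h3 : (2 : ℂ) • (E * cf 1 G * E) = 0 := by
      rw [two_smul]; nth_rewrite 1 [← h2]; exact neg_add_cancel _
    simpa using h3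
  have hJ : (1 - (E + E)) * (1 - (E + E)) = 1 := by
    simp only [sub_mul, mul_sub, add_mul, mul_add, one_mul, mul_one, hEE]; abel
  have hJS : (1 - (E + E)) * S = S * (1 - (E + E)) := by
    simp only [sub_mul, mul_sub, add_mul, mul_add, one_mul, mul_one, hcomm]
  have hJH : (1 - (E + E))ᴴ = 1 - (E + E) := by simp [hE]
  have hBB := conjTranspose_mul_bmat hE hEE
  have hBB' := bmat_mul_conjTranspose hE hEE
  have hBF := (bmat_entriesIn hEF).conjTranspose fun x => star_mem_coeffSubring hF
  have hBS := cmat_mul_bmat_conjTranspose_comm hE hcomm.symm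
  have hBJ := cmat_mul_bmat_conjTranspose_comm hE (X := 1 - (E + E))
    (by simp only [sub_mul, mul_sub, add_mul, mul_add, one_mul, mul_one])
  refine ⟨(hBF.mul h.entries).mul hBF, ?_, ?_, ?_, ?_, ?_, ?_, ?_⟩
  · intro k hk
    rw [cf_reduce hE, h.lowerBound k hk]
    rcases (show k = -1 ∨ k = -2 ∨ k + 1 + 1 < 0 by omega) with rfl | rfl | hk2
    · norm_num [add_mul, Matrix.mul_assoc, h0, h0', h1]
    · norm_num [add_mul, Matrix.mul_assoc, h0, h.lowerBound (-1) (by norm_num)]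
    · rw [h.lowerBound _ (show k + 1 < 0 by omega), h.lowerBound _ hk2]; simp
  · rw [Matrix.conjTranspose_mul, Matrix.conjTranspose_mul, Matrix.conjTranspose_conjTranspose]
    calc _ = (bmat E)ᴴ * (G * ((bmat E)ᴴ * bmat E) * Gᴴ) * bmat E := by
          simp only [Matrix.mul_assoc]
      _ = 1 := by rw [hBB, Matrix.mul_one, h.paraunitary, Matrix.mul_one, hBB]
  · rw [map_mul_invert, map_mul_invert, h.invert_eq, ← bmat_invert hE, map_invert_invert,
      bmat_invert hE, Matrix.conjTranspose_mul, Matrix.conjTranspose_mul,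
      Matrix.conjTranspose_conjTranspose, Matrix.mul_assoc]
  · have h2 : (bmat E)ᴴ.map negSubst = (bmat E)ᴴ * cmat (1 - (E + E)) := by
      rw [conjTranspose_map_negSubst, bmat_negSubst hEE, Matrix.conjTranspose_mul,
        cmat_conjTranspose, hJH]
    rw [map_mul_negSubst, map_mul_negSubst, h2, h.negSubst_eq]
    calc (bmat E)ᴴ * cmat (1 - (E + E)) * (cmat S * G * cmat S) * ((bmat E)ᴴ * cmat (1 - (E + E)))
        = ((bmat E)ᴴ * (cmat (1 - (E + E)) * cmat S)) * G *
          (cmat S * (bmat E)ᴴ * cmat (1 - (E + E))) := by simp only [Matrix.mul_assoc]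
      _ = (cmat S * (cmat (1 - (E + E)) * (bmat E)ᴴ)) * G *
          ((bmat E)ᴴ * (cmat S * cmat (1 - (E + E)))) := by
          rw [← cmat_mul, hJS, hBS, cmat_mul, hBJ, ← Matrix.mul_assoc (cmat S) (bmat E)ᴴ, hBS]
          simp only [Matrix.mul_assoc]
      _ = _ := by rw [cmat_mul]; simp only [Matrix.mul_assoc]
  · exact h.grading_entries.mul (EntriesIn.one.sub (hEF.add hEF))
  · rw [Matrix.conjTranspose_mul, hJH, h.grading_hermitian, hJS]
  · calc S * (1 - (E + E)) * (S * (1 - (E + E))) = S * ((1 - (E + E)) * S) * (1 - (E + E)) := by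
          simp only [Matrix.mul_assoc]
      _ = (S * S) * ((1 - (E + E)) * (1 - (E + E))) := by rw [hJS]; simp only [Matrix.mul_assoc]
      _ = 1 := by rw [h.grading_sq, hJ, Matrix.mul_one]

/-- The conclusion of the factorization of a graded reflection `G`: a paraunitary change of basis
`A`, polynomial in `w`, after which the reflection acts by a constant Hermitian involution `D` that
commutes with the grading `S'`. -/
def Factors (F : Subfield ℂ) (G : LMat n n) (S : Matrix n n ℂ) : Prop :=
  ∃ (A : LMat n n) (D S' : Matrix n n ℂ), EntriesIn (coeffSubring F) A ∧ LowerBound 0 A ∧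
    A * Aᴴ = 1 ∧ EntriesIn F.toSubring D ∧ EntriesIn F.toSubring S' ∧ Dᴴ = D ∧ D * D = 1 ∧
    S'ᴴ = S' ∧ S' * S' = 1 ∧ D * S' = S' * D ∧ A.map invert * G = cmat D * A ∧
    A.map negSubst = cmat S' * A * cmat S

/-- A factorization of the reduced reflection `(I - E + w⁻¹E) G (I - E + w⁻¹E)` gives one of `G`. -/
theorem factors_of_reduce (h : IsGradedReflection F G S)
    (hEF : EntriesIn F.toSubring E) (hE : Eᴴ = E) (hEE : E * E = E)
    (hSE : S * E = E ∨ S * E = -E)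
    (hf : Factors F ((bmat E)ᴴ * G * (bmat E)ᴴ) (S * (1 - (E + E)))) : Factors F G S := by
  obtain ⟨A, D, S', hAF, hA0, hA, hDF, hSF, hD, hDD, hS', hSS', hDS, hAG, hAn⟩ := hf
  have hES : E * S = (S * E)ᴴ := by rw [Matrix.conjTranspose_mul, hE, h.grading_hermitian]
  have hcomm : E * S = S * E := by
    rcases hSE with h | h <;> rw [hES, h] <;> simp [hE]
  have hBB := conjTranspose_mul_bmat hE hEE
  have hBB' := bmat_mul_conjTranspose hE hEE
  have hJ : (1 - (E + E)) * (1 - (E + E)) = 1 := by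
    simp only [sub_mul, mul_sub, add_mul, mul_add, one_mul, mul_one, hEE]; abel
  have hBS := cmat_mul_bmat_comm hcomm.symm
  refine ⟨A * bmat E, D, S', hAF.mul (bmat_entriesIn hEF), ?_, ?_, hDF, hSF, hD, hDD, hS', hSS',
    hDS, ?_, ?_⟩
  · simpa using hA0.mul (lowerBound_bmat E)
  · rw [Matrix.conjTranspose_mul, Matrix.mul_assoc, ← Matrix.mul_assoc _ _ Aᴴ, hBB',
      Matrix.one_mul, hA]
  · calc (A * bmat E).map invert * G = A.map invert * ((bmat E)ᴴ * G) * ((bmat E)ᴴ * bmat E) := by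
          rw [map_mul_invert, bmat_invert hE, hBB, Matrix.mul_one, Matrix.mul_assoc]
      _ = A.map invert * ((bmat E)ᴴ * G * (bmat E)ᴴ) * bmat E := by simp only [Matrix.mul_assoc]
      _ = _ := by rw [hAG, Matrix.mul_assoc]
  · rw [map_mul_negSubst, hAn, bmat_negSubst hEE]
    calc cmat S' * A * cmat (S * (1 - (E + E))) * (cmat (1 - (E + E)) * bmat E)
        = cmat S' * A * (cmat S * (cmat (1 - (E + E)) * cmat (1 - (E + E))) * bmat E) := by
          rw [cmat_mul]; simp only [Matrix.mul_assoc]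
      _ = _ := by rw [← cmat_mul, hJ, cmat_one, Matrix.mul_one, hBS]; simp only [Matrix.mul_assoc]

/-- Every graded reflection becomes constant after a polynomial paraunitary change of basis, by
induction on the degree: the even and the odd part of the range of the top coefficient `G_N` are
split off, which is possible since `G(0) G_N = 0`. -/
theorem factors (hF : ∀ x ∈ F, (starRingEnd ℂ) x ∈ F) (N : ℕ) (h : IsGradedReflection F G S)
    (hG : ∀ k > (N : ℤ), cf k G = 0) : Factors F G S := by
  induction N generalizing G S with
  | zero =>
    have hconst : G = cmat (cf 0 G) := ext_cf fun k => by
      rw [cf_cmat]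
      split_ifs with h'
      · rw [h']
      · rcases lt_or_gt_of_ne h' with h' | h'
        · exact h.lowerBound k h'
        · exact hG k (by simpa using h')
    have h1 : cf 0 G * cf 0 G = 1 := by
      apply cmat_injective
      have := h.paraunitary
      rwa [hconst, cmat_conjTranspose, h.cf_hermitian, ← cmat_mul, ← cmat_one] at this
    have h2 : cf 0 G * S = S * cf 0 G := by
      have h3 := h.cf_grading 0
      rw [zpow_zero, one_smul] at h3
      conv_lhs => rw [h3]
      rw [Matrix.mul_assoc, h.grading_sq, Matrix.mul_one]
    refine ⟨1, cf 0 G, S, EntriesIn.one, ?_, by simp, cf_entriesIn h.entries 0, h.grading_entries,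
      h.cf_hermitian 0, h1, h.grading_hermitian, h.grading_sq, h2, ?_, ?_⟩
    · rw [← cmat_one]; exact lowerBound_cmat 1
    · rw [← cmat_one, cmat_invert, cmat_one, Matrix.one_mul, Matrix.mul_one, ← hconst]
    · rw [← cmat_one, cmat_negSubst, cmat_one, Matrix.mul_one, ← cmat_mul, h.grading_sq, cmat_one]
  | succ N ih =>
    have hpos : (0 : ℤ) < ((N + 1 : ℕ) : ℤ) := by push_cast; omega
    obtain ⟨E, hEF, hEH, hEE, hTE, Y, hY⟩ :=
      exists_range_projection hF (cf_entriesIn h.entries ((N + 1 : ℕ) : ℤ))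
    have hTH := h.cf_hermitian ((N + 1 : ℕ) : ℤ)
    have hTS := h.cf_grading ((N + 1 : ℕ) : ℤ)
    have hT0 := h.cf_zero_mul_top hpos hG
    set L := cf ((N + 1 : ℕ) : ℤ) G with hL
    rw [hTH] at hY
    have hET : E * L = L := by
      rw [← hEH, ← hTH, ← Matrix.conjTranspose_mul, hTE]
    -- the range of the top coefficient is invariant under the grading
    have hcomm : S * E = E * S := by
      have h1 : S * L = (-1 : ℂ) ^ ((N + 1 : ℕ) : ℤ) • (L * S) := by
        rw [← Matrix.smul_mul, hTS, Matrix.mul_assoc, h.grading_sq, Matrix.mul_one]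
      have h2 : E * S * E = S * E := by
        conv_rhs => rw [hY, ← Matrix.mul_assoc, h1]
        conv_lhs => rw [Matrix.mul_assoc]; rw [hY]; rw [← Matrix.mul_assoc S, h1]
        rw [← hY]
        simp only [Matrix.smul_mul, Matrix.mul_smul, ← Matrix.mul_assoc, hET]
      rw [← h2]
      calc E * S * E = (E * S * E)ᴴ := by
            simp only [Matrix.conjTranspose_mul, hEH, h.grading_hermitian, Matrix.mul_assoc]
        _ = _ := by rw [h2, Matrix.conjTranspose_mul, hEH, h.grading_hermitian]
    -- the even part of that range
    set Ep := (2⁻¹ : ℂ) • (E + S * E) with hEp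
    have hSEp : S * Ep = Ep := by
      rw [hEp, Matrix.mul_smul, mul_add, ← Matrix.mul_assoc, h.grading_sq, Matrix.one_mul, add_comm]
    have hEEp : E * Ep = Ep := by
      rw [hEp, Matrix.mul_smul, mul_add, hEE, hcomm, ← Matrix.mul_assoc, hEE]
    have hEpH : Epᴴ = Ep := by
      rw [hEp, Matrix.conjTranspose_smul, Matrix.conjTranspose_add, Matrix.conjTranspose_mul, hEH,
        h.grading_hermitian, hcomm]
      simp
    have hEpEp : Ep * Ep = Ep := by
      conv_lhs => enter [1]; rw [hEp]
      rw [Matrix.smul_mul, add_mul, Matrix.mul_assoc, hEEp, hSEp, ← two_smul ℂ Ep, smul_smul]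
      norm_num
    have hEpE : Ep * E = Ep := by
      rw [← hEpH, ← hEH, ← Matrix.conjTranspose_mul, hEEp]
    have hEpF : EntriesIn F.toSubring Ep := by
      have h1 := hEF.add (h.grading_entries.mul hEF)
      exact fun i j => F.mul_mem (F.inv_mem (natCast_mem F 2)) (h1 i j)
    have h0E : cf 0 G * E = 0 := by rw [hY, ← Matrix.mul_assoc, hT0, Matrix.zero_mul]
    have h0 : cf 0 G * Ep = 0 := by
      rw [← hEEp, ← Matrix.mul_assoc, h0E, Matrix.zero_mul]
    refine h.factors_of_reduce hEpF hEpH hEpEp (Or.inl hSEp) ?_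
    have h' := h.reduce hF hEpF hEpH hEpEp h0 (Or.inl hSEp)
    have hG' : ∀ k > ((N + 1 : ℕ) : ℤ), cf k ((bmat Ep)ᴴ * G * (bmat Ep)ᴴ) = 0 := fun k hk => by
      rw [cf_reduce hEpH, hG k hk, hG (k + 1) (by omega), hG (k + 1 + 1) (by omega)]; simp
    have hL' : cf ((N + 1 : ℕ) : ℤ) ((bmat Ep)ᴴ * G * (bmat Ep)ᴴ) = (1 - Ep) * L * (1 - Ep) := by
      rw [cf_reduce hEpH, ← hL, hG _ (by omega), hG _ (by omega)]; simp
    generalize (bmat Ep)ᴴ * G * (bmat Ep)ᴴ = G' at *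
    -- what is left of the top coefficient is odd for the new grading
    have hSL' : S * (1 - (Ep + Ep)) * cf ((N + 1 : ℕ) : ℤ) G' = -cf ((N + 1 : ℕ) : ℤ) G' := by
      have h1 : S * (1 - (Ep + Ep)) * (1 - Ep) * E = -((1 - Ep) * E) := by
        have h2 : S * (1 - (Ep + Ep)) * (1 - Ep) * E = S * E - S * Ep := by
          simp only [mul_sub, sub_mul, mul_add, add_mul, mul_one, Matrix.mul_assoc, hEpEp, hEpE]
          abel
        have h3 : S * E = (2 : ℂ) • Ep - E := by rw [hEp, smul_smul]; norm_num
        rw [h2, hSEp, h3, sub_mul, one_mul, hEpE, two_smul]; abel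
      rw [hL', ← hET]
      calc _ = S * (1 - (Ep + Ep)) * (1 - Ep) * E * L * (1 - Ep) := by
            simp only [Matrix.mul_assoc]
        _ = _ := by rw [h1]; simp only [Matrix.mul_assoc, Matrix.neg_mul]
    obtain ⟨E', hEF', hEH', hEE', hTE', Y', hY'⟩ :=
      exists_range_projection hF (cf_entriesIn h'.entries ((N + 1 : ℕ) : ℤ))
    rw [h'.cf_hermitian] at hY'
    have hSE' : S * (1 - (Ep + Ep)) * E' = -E' := by
      rw [hY', ← Matrix.mul_assoc, hSL', Matrix.neg_mul]
    have h0' : cf 0 G' * E' = 0 := by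
      rw [hY', ← Matrix.mul_assoc, h'.cf_zero_mul_top hpos hG', Matrix.zero_mul]
    refine h'.factors_of_reduce hEF' hEH' hEE' (Or.inr hSE') ?_
    refine ih (h'.reduce hF hEF' hEH' hEE' h0' (Or.inr hSE')) fun k hk => ?_
    rw [cf_reduce hEH', hG' (k + 1) (by push_cast; omega), hG' (k + 1 + 1) (by push_cast; omega)]
    rcases (show k = ((N + 1 : ℕ) : ℤ) ∨ k > ((N + 1 : ℕ) : ℤ) by push_cast; omega) with hk | hk
    · rw [hk, Matrix.mul_zero, add_zero, Matrix.mul_assoc, mul_sub, hTE', Matrix.mul_one, sub_self]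
      simp
    · rw [hG' k hk]; simp

end IsGradedReflection

end Reflection

/-! ### Completion with symmetry -/

section SymmetricCompletion

variable {ι κ n : Type*} [Fintype ι] [Fintype κ] [Fintype n] [DecidableEq ι] [DecidableEq κ]
  [DecidableEq n]

/-- Multiplication of column `j` by `s_j w^(2 L_j)`. Together with `w ↦ 1/w` it is a reflection that
exchanges the exponents `0` and `2 L_j`. -/
noncomputable def reflMat (s : n → ℤˣ) (L : n → ℤ) : LMat n n :=
  Matrix.diagonal fun j => C ((s j : ℤ) : ℂ) * T (2 * L j)

theorem C_units_mul_self (e : ℤˣ) :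
    (C ((e : ℤ) : ℂ) * C ((e : ℤ) : ℂ) : ℂ[T;T⁻¹]) = 1 := by
  rw [← map_mul]
  rcases Int.units_eq_one_or e with rfl | rfl <;> simp

theorem star_C_units (e : ℤˣ) : star (C ((e : ℤ) : ℂ) : ℂ[T;T⁻¹]) = C ((e : ℤ) : ℂ) := by
  rcases Int.units_eq_one_or e with rfl | rfl <;> simp

theorem reflMat_mul_conjTranspose (s : n → ℤˣ) (L : n → ℤ) :
    reflMat s L * (reflMat s L)ᴴ = 1 := by
  rw [reflMat, Matrix.diagonal_conjTranspose, Matrix.diagonal_mul_diagonal, ← Matrix.diagonal_one]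
  congr 1
  funext j
  simp only [Pi.star_apply, star_mul', star_C_units, star_T]
  rw [mul_mul_mul_comm, C_units_mul_self, ← T_add]; simp

omit [Fintype n] in
theorem reflMat_invert (s : n → ℤˣ) (L : n → ℤ) :
    (reflMat s L).map invert = (reflMat s L)ᴴ := by
  rw [reflMat, Matrix.diagonal_conjTranspose, Matrix.diagonal_map (map_zero _)]
  congr 1
  funext j
  simp only [Pi.star_apply, star_mul', star_C_units, star_T, map_mul, invert_C, invert_T]

omit [Fintype n] in
theorem reflMat_negSubst (s : n → ℤˣ) (L : n → ℤ) : (reflMat s L).map negSubst = reflMat s L := by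
  rw [reflMat, Matrix.diagonal_map (map_zero _)]
  congr 1
  funext j
  simp only [map_mul, negSubst_C, negSubst_T, (even_two_mul (L j)).neg_one_zpow, map_one, one_mul]

omit [Fintype n] in
theorem lowerBound_reflMat (s : n → ℤˣ) {L : n → ℤ} (hL : ∀ j, 0 ≤ L j) :
    LowerBound 0 (reflMat s L) := fun k hk => by
  ext i j
  simp only [cf, Matrix.map_apply, reflMat, Matrix.diagonal_apply]
  split_ifs with h
  · rw [coeff_C_mul, T_apply, if_neg (by have := hL i; omega)]; simp
  · simp

theorem units_mem (F : Subfield ℂ) (e : ℤˣ) : ((e : ℤ) : ℂ) ∈ F := intCast_mem F _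

omit [Fintype n] in
theorem reflMat_entriesIn {F : Subfield ℂ} (s : n → ℤˣ) (L : n → ℤ) :
    EntriesIn (coeffSubring F) (reflMat s L) := fun i j => by
  rw [reflMat, Matrix.diagonal_apply]
  split_ifs
  · exact Subring.mul_mem _ (C_mem_coeffSubring (units_mem F _)) (T_mem_coeffSubring _)
  · exact Subring.zero_mem _

omit [Fintype κ] [DecidableEq κ] in
theorem coeff_mul_reflMat (M : LMat κ n) (s : n → ℤˣ) (L : n → ℤ) (i : κ) (j : n) (k : ℤ) :
    ((M.map invert * reflMat s L) i j).coeff k = (s j : ℤ) * (M i j).coeff (2 * L j - k) := by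
  rw [reflMat, Matrix.mul_diagonal, mul_comm, mul_assoc, coeff_C_mul, coeff_T_mul,
    Matrix.map_apply, invert_apply, neg_sub]

omit [Fintype κ] [DecidableEq κ] in
/-- `M` has degree at most `2 L_j` in column `j`, expressed in two ways. -/
theorem lowerBound_reflMat_mul_conjTranspose_iff {M : LMat κ n} {s : n → ℤˣ} {L : n → ℤ} :
    LowerBound 0 (reflMat s L * Mᴴ) ↔ LowerBound 0 (M.map invert * reflMat s L) := by
  have h1 : ∀ i j k, ((reflMat s L * Mᴴ) j i).coeff k =
      (s j : ℤ) * star ((M i j).coeff (2 * L j - k)) := fun i j k => by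
    rw [reflMat, Matrix.diagonal_mul, mul_assoc, coeff_C_mul, coeff_T_mul,
      Matrix.conjTranspose_apply, star_coeff, neg_sub]
  have h2 : ∀ j, ((s j : ℤ) : ℂ) ≠ 0 := fun j => by simp
  constructor
  · intro h k hk
    ext i j
    have h3 := (h1 i j k).symm.trans (h.entry j i hk)
    have h4 := (mul_eq_zero.1 h3).resolve_left (h2 j)
    exact (coeff_mul_reflMat M s L i j k).trans (by rw [star_eq_zero.1 h4]; simp)
  · intro h k hk
    ext j i
    have h3 := (coeff_mul_reflMat M s L i j k).symm.trans (h.entry i j hk)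
    have h4 := (mul_eq_zero.1 h3).resolve_left (h2 j)
    exact (h1 i j k).trans (by rw [h4]; simp)

theorem negSubst_mem_coeffSubring {F : Subfield ℂ} {p : ℂ[T;T⁻¹]} (hp : p ∈ coeffSubring F) :
    negSubst p ∈ coeffSubring F := by
  rw [mem_coeffSubring] at *
  intro k
  rw [negSubst_coeff]
  exact F.mul_mem (zpow_mem (neg_mem F.one_mem) k) (hp k)

theorem map_negSubst_negSubst {m n : Type*} (M : LMat m n) :
    (M.map negSubst).map negSubst = M := by
  ext i j k
  simp only [Matrix.map_apply, negSubst_coeff, ← mul_assoc, ← mul_zpow]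
  simp

theorem map_negSubst_map_invert {m n : Type*} (M : LMat m n) :
    (M.map negSubst).map invert = (M.map invert).map negSubst := by
  ext i j : 2
  simp [negSubst_invert]

omit [DecidableEq κ] [DecidableEq n] in
theorem exists_upperBound (M : LMat κ n) : ∃ N : ℕ, ∀ k > (N : ℤ), cf k M = 0 := by
  obtain ⟨N, hN⟩ := exists_lowerBound Mᴴ
  refine ⟨N, fun k hk => ?_⟩
  have := hN (-k) (by omega)
  rwa [cf_conjTranspose, neg_neg, Matrix.conjTranspose_eq_zero] at this

/-- Completion with symmetry. The rows `P` have no negative exponents, degree at most `2 L_j` in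
column `j`, and span a module that is invariant under the reflection `w ↦ 1/w` (combined with
`reflMat s L`) and under the grading `w ↦ -w` (combined with `S`). Then the completing rows can be
chosen as eigenvectors of the reflection and of the grading, with the same bounds on the
exponents. -/
theorem exists_symmetric_completion {F : Subfield ℂ} (hF : ∀ x ∈ F, (starRingEnd ℂ) x ∈ F)
    (hsqrt : ∀ y : ℝ, 0 < y → (y : ℂ) ∈ F → ((√y : ℝ) : ℂ) ∈ F)
    (hcard : Fintype.card ι + Fintype.card κ = Fintype.card n) {P : LMat ι n}
    (hPF : EntriesIn (coeffSubring F) P) (hP : P * Pᴴ = 1) (hP0 : LowerBound 0 P)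
    {s : n → ℤˣ} {L : n → ℤ} (hL : ∀ j, 0 ≤ L j) (hPL : LowerBound 0 (P.map invert * reflMat s L))
    {S : Matrix n n ℂ} (hSF : EntriesIn F.toSubring S) (hSH : Sᴴ = S) (hSS : S * S = 1)
    (hSL : cmat S * reflMat s L = reflMat s L * cmat S) {R R' : Matrix ι ι ℂ}
    (hPR : P = cmat R * (P.map invert * reflMat s L))
    (hPR' : P = cmat R' * (P.map negSubst * cmat S)) :
    ∃ (Q : LMat κ n) (δ θ : κ → ℤˣ), EntriesIn (coeffSubring F) Q ∧ Q * Qᴴ = 1 ∧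
      Pᴴ * P + Qᴴ * Q = 1 ∧ LowerBound 0 Q ∧
      Q.map invert * reflMat s L = cmat (Matrix.diagonal fun i => ((δ i : ℤ) : ℂ)) * Q ∧
      Q.map negSubst * cmat S = cmat (Matrix.diagonal fun i => ((θ i : ℤ) : ℂ)) * Q := by
  obtain ⟨N, hN⟩ := exists_upperBound P
  obtain ⟨Q, hQF, hQ, hPQ, hQ0, hinj⟩ := exists_completion (κ := κ) hF hsqrt hcard N P hPF hP hP0 hN
  have hQP := mul_conjTranspose_eq_zero hQ hPQ hP
  have hcS : cmat S * cmat S = 1 := by rw [← cmat_mul, hSS, cmat_one]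
  have hcSH : (cmat S)ᴴ = cmat S := by rw [cmat_conjTranspose, hSH]
  set Λ := reflMat s L with hΛ
  have hΛΛ : Λ * Λᴴ = 1 := reflMat_mul_conjTranspose s L
  -- for rows `V` orthogonal to `P`, the matrix `V Qᴴ` of coordinates is as unitary as `V`
  have hunit : ∀ V : LMat κ n, V * Pᴴ = 0 → V * Qᴴ * (V * Qᴴ)ᴴ = V * Vᴴ := fun V hV => by
    have h1 : V * (Pᴴ * P + Qᴴ * Q) * Vᴴ = V * Vᴴ := by rw [hPQ, Matrix.mul_one]
    rw [Matrix.mul_add, ← Matrix.mul_assoc V Pᴴ, hV, Matrix.zero_mul, zero_add] at h1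
    rw [Matrix.conjTranspose_mul, Matrix.conjTranspose_conjTranspose, ← h1]
    simp only [Matrix.mul_assoc]
  -- the bound on the degrees of `Q`
  have hQL : LowerBound 0 (Q.map invert * Λ) := by
    rw [← lowerBound_reflMat_mul_conjTranspose_iff]
    refine LowerBound.of_mul_right hQ0 hinj ?_
    have h1 : reflMat s L * Qᴴ * Q = reflMat s L - reflMat s L * Pᴴ * P := by
      rw [Matrix.mul_assoc, Matrix.mul_assoc, eq_sub_of_add_eq' hPQ, Matrix.mul_sub,
        Matrix.mul_one]
    rw [h1]
    refine (lowerBound_reflMat s hL).sub ?_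
    simpa using (lowerBound_reflMat_mul_conjTranspose_iff.2 hPL).mul hP0
  -- the grading acts on `Q` by a constant matrix
  obtain ⟨S₃, hS₃F, hS₃H, hS₃S, hS₃⟩ : ∃ S₃ : Matrix κ κ ℂ, EntriesIn F.toSubring S₃ ∧ S₃ᴴ = S₃ ∧
      S₃ * S₃ = 1 ∧ Q.map negSubst * cmat S = cmat S₃ * Q := by
    have hV : Q.map negSubst * cmat S * Pᴴ = 0 := by
      rw [hPR', Matrix.conjTranspose_mul, Matrix.conjTranspose_mul, hcSH, Matrix.mul_assoc,
        ← Matrix.mul_assoc (cmat S), ← Matrix.mul_assoc (cmat S), hcS, Matrix.one_mul,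
        ← Matrix.mul_assoc, ← conjTranspose_map_negSubst, ← map_mul_negSubst, hQP]
      ext i j : 2; simp [Matrix.mul_apply]
    have hV0 : LowerBound 0 (Q.map negSubst * cmat S) := fun k hk => by
      rw [cf_mul_cmat, cf_negSubst, hQ0 k hk]; simp
    obtain ⟨h1, h2⟩ := eq_mul_of_completion hPQ hQ0 hinj hV hV0
    have h3 := hunit _ hV
    have h4 : Q.map negSubst * cmat S * (Q.map negSubst * cmat S)ᴴ = 1 := by
      rw [Matrix.conjTranspose_mul, hcSH, Matrix.mul_assoc, ← Matrix.mul_assoc (cmat S), hcS,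
        Matrix.one_mul, ← conjTranspose_map_negSubst, ← map_mul_negSubst, hQ, ← cmat_one,
        cmat_negSubst]
    rw [h4] at h3
    have h5 : (Q.map negSubst * cmat S * Qᴴ).map negSubst = (Q.map negSubst * cmat S * Qᴴ)ᴴ := by
      rw [map_mul_negSubst, map_mul_negSubst, map_negSubst_negSubst, cmat_negSubst,
        Matrix.conjTranspose_mul, Matrix.conjTranspose_mul, Matrix.conjTranspose_conjTranspose,
        hcSH, conjTranspose_map_negSubst, Matrix.mul_assoc]
    set X := Q.map negSubst * cmat S * Qᴴ
    have hX : X = cmat (cf 0 X) := ext_cf fun k => by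
      rw [cf_cmat]
      split_ifs with h'
      · rw [h']
      · rcases lt_or_gt_of_ne h' with h' | h'
        · exact h2 k h'
        · have h6 := congrArg (cf (-k)) h5
          rw [cf_conjTranspose, neg_neg, cf_negSubst, h2 (-k) (by omega), smul_zero] at h6
          exact Matrix.conjTranspose_eq_zero.1 h6.symm
    have hXH : (cf 0 X)ᴴ = cf 0 X := by
      apply cmat_injective
      rw [← cmat_conjTranspose, ← hX, ← h5]
      conv_lhs => rw [hX]
      rw [cmat_negSubst, ← hX]
    have hXX : cf 0 X * cf 0 X = 1 := by
      apply cmat_injective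
      rw [cmat_mul, cmat_one, ← h3]
      conv_lhs => enter [2]; rw [← hXH, ← cmat_conjTranspose]
      rw [← hX]
    refine ⟨cf 0 X, ?_, hXH, hXX, ?_⟩
    · exact cf_entriesIn ((EntriesIn.mul (fun i j => negSubst_mem_coeffSubring (hQF i j))
        (cmat_entriesIn hSF)).mul (hQF.conjTranspose fun x => star_mem_coeffSubring hF)) 0
    · rw [← hX, h1]
  have hcS₃ : cmat S₃ * cmat S₃ = 1 := by rw [← cmat_mul, hS₃S, cmat_one]
  have hQn : Q.map negSubst = cmat S₃ * Q * cmat S := by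
    rw [← hS₃, Matrix.mul_assoc, hcS, Matrix.mul_one]
  -- the reflection acts on `Q` by a graded reflection matrix
  have hV : Q.map invert * Λ * Pᴴ = 0 := by
    rw [hPR, Matrix.conjTranspose_mul, Matrix.conjTranspose_mul, Matrix.mul_assoc,
      ← Matrix.mul_assoc Λ, ← Matrix.mul_assoc Λ, hΛΛ, Matrix.one_mul,
      ← Matrix.mul_assoc, ← conjTranspose_map_invert, ← map_mul_invert, hQP]
    ext i j : 2; simp [Matrix.mul_apply]
  obtain ⟨h1, h2⟩ := eq_mul_of_completion hPQ hQ0 hinj hV hQL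
  have hG : IsGradedReflection F (Q.map invert * Λ * Qᴴ) S₃ := by
    refine ⟨?_, h2, ?_, ?_, ?_, hS₃F, hS₃H, hS₃S⟩
    · exact (EntriesIn.mul (fun i j => invert_mem_coeffSubring (hQF i j))
        (reflMat_entriesIn s L)).mul (hQF.conjTranspose fun x => star_mem_coeffSubring hF)
    · rw [hunit _ hV, Matrix.conjTranspose_mul, Matrix.mul_assoc, ← Matrix.mul_assoc Λ, hΛΛ,
        Matrix.one_mul, ← conjTranspose_map_invert, ← map_mul_invert, hQ, ← cmat_one, cmat_invert]
    · rw [map_mul_invert, map_mul_invert, map_invert_invert, hΛ, reflMat_invert,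
        conjTranspose_map_invert, Matrix.conjTranspose_mul, Matrix.conjTranspose_mul,
        Matrix.conjTranspose_conjTranspose, Matrix.mul_assoc]
    · rw [map_mul_negSubst, map_mul_negSubst, conjTranspose_map_negSubst,
        ← map_negSubst_map_invert, hQn, map_mul_invert, map_mul_invert, cmat_invert, cmat_invert,
        hΛ, reflMat_negSubst, Matrix.conjTranspose_mul, Matrix.conjTranspose_mul, hcSH,
        cmat_conjTranspose, hS₃H, ← hΛ]
      calc cmat S₃ * Q.map invert * cmat S * Λ * (cmat S * (Qᴴ * cmat S₃))
          = cmat S₃ * Q.map invert * (cmat S * Λ) * cmat S * Qᴴ * cmat S₃ := by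
            simp only [Matrix.mul_assoc]
        _ = cmat S₃ * Q.map invert * Λ * (cmat S * cmat S) * Qᴴ * cmat S₃ := by
            rw [hSL]; simp only [Matrix.mul_assoc]
        _ = _ := by rw [hcS]; simp only [Matrix.mul_assoc, Matrix.one_mul]
  obtain ⟨M, hM⟩ := exists_upperBound (Q.map invert * Λ * Qᴴ)
  obtain ⟨A, D, S', hAF, hA0, hA, hDF, hSF, hDH, hDD, hSH', hSS', hDS, hAG, hAn⟩ :=
    hG.factors hF M hM
  -- diagonalize the reflection and the grading simultaneously
  obtain ⟨U, δ, θ, hUF, hU, -, hUD, hUS⟩ := exists_unitary_eigenrows (ι := Fin 0) (κ := κ) hF hsqrt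
    (P := 0) (fun i => i.elim0) hDF hSF hDH hSH' hDD hSS' hDS ⟨0, Subsingleton.elim _ _⟩
    ⟨0, Subsingleton.elim _ _⟩ (by simp)
  have hW : cmat U * A * (cmat U * A)ᴴ = 1 := by
    rw [Matrix.conjTranspose_mul, Matrix.mul_assoc, ← Matrix.mul_assoc A, hA, Matrix.one_mul,
      cmat_conjTranspose, ← cmat_mul, hU, cmat_one]
  refine ⟨cmat U * A * Q, δ, θ, ((cmat_entriesIn hUF).mul hAF).mul hQF, ?_, ?_, ?_, ?_, ?_⟩
  · rw [Matrix.conjTranspose_mul, Matrix.mul_assoc, ← Matrix.mul_assoc Q, hQ, Matrix.one_mul, hW]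
  · rw [Matrix.conjTranspose_mul, Matrix.mul_assoc, ← Matrix.mul_assoc _ _ Q, mul_eq_one_comm.1 hW,
      Matrix.one_mul, hPQ]
  · simpa using ((lowerBound_cmat U).mul hA0).mul hQ0
  · calc (cmat U * A * Q).map invert * Λ = cmat U * A.map invert * (Q.map invert * Λ) := by
          rw [map_mul_invert, map_mul_invert, cmat_invert, Matrix.mul_assoc]
      _ = cmat U * (A.map invert * (Q.map invert * Λ * Qᴴ)) * Q := by
          conv_lhs => rw [← h1]
          simp only [Matrix.mul_assoc]
      _ = cmat (U * D) * A * Q := by rw [hAG, cmat_mul]; simp only [Matrix.mul_assoc]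
      _ = _ := by rw [hUD, cmat_mul]; simp only [Matrix.mul_assoc]
  · calc (cmat U * A * Q).map negSubst * cmat S
        = cmat U * (A.map negSubst) * (Q.map negSubst * cmat S) := by
          rw [map_mul_negSubst, map_mul_negSubst, cmat_negSubst, Matrix.mul_assoc]
      _ = cmat U * cmat S' * A * (cmat S₃ * cmat S₃) * Q := by
          rw [hAn, hS₃]; simp only [Matrix.mul_assoc]
      _ = cmat (U * S') * A * Q := by rw [hcS₃, cmat_mul, Matrix.mul_one]
      _ = _ := by rw [hUS, cmat_mul]; simp only [Matrix.mul_assoc]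

end SymmetricCompletion

/-! ### The substitution `z = w²` -/

theorem hasSym_iff_coeff {p : ℂ[T;T⁻¹]} {e : ℤˣ} {c : ℤ} :
    HasSym p e c ↔ ∀ n, p.coeff n = (e : ℤ) * p.coeff (c - n) := by
  have h : ∀ n, (C ((e : ℤ) : ℂ) * T c * invert p).coeff n = (e : ℤ) * p.coeff (c - n) :=
      fun n => by
    rw [mul_assoc, coeff_C_mul, coeff_T_mul, invert_apply, neg_sub]
  constructor
  · intro hp n
    rw [← h n]
    exact congrArg (fun q => q.coeff n) hp
  · exact fun hp => LaurentPolynomial.ext fun n => (hp n).trans (h n).symm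

theorem sub_le_of_coeffLength_le {p : ℂ[T;T⁻¹]} {L : ℤ} (h : coeffLength p ≤ (L : WithBot ℤ))
    {a b : ℤ} (ha : p.coeff a ≠ 0) (hb : p.coeff b ≠ 0) : a - b ≤ L := by
  have ha' := Finsupp.mem_support_iff.2 ha
  have hb' := Finsupp.mem_support_iff.2 hb
  rw [coeffLength, finsetLength, dif_pos ⟨a, ha'⟩, WithBot.coe_le_coe] at h
  have h1 := Finset.le_max' _ a ha'
  have h2 := Finset.min'_le _ b hb'
  omega

theorem finsetLength_le {A : Finset ℤ} {L : ℤ} (h : ∀ a ∈ A, ∀ b ∈ A, a - b ≤ L) :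
    finsetLength A ≤ (L : WithBot ℤ) := by
  rw [finsetLength]
  split_ifs with hA
  · exact WithBot.coe_le_coe.2 (h _ (Finset.max'_mem _ hA) _ (Finset.min'_mem _ hA))
  · exact bot_le

/-- The substitution `z = w²`. -/
noncomputable def dbl : ℂ[T;T⁻¹] →+* ℂ[T;T⁻¹] :=
  AddMonoidAlgebra.mapDomainRingHom ℂ (AddMonoidHom.mulLeft (2 : ℤ))

theorem two_mul_injective : Function.Injective fun n : ℤ => 2 * n :=
  fun a b h => by simpa using h

theorem dbl_coeff_two_mul (p : ℂ[T;T⁻¹]) (n : ℤ) : (dbl p).coeff (2 * n) = p.coeff n :=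
  Finsupp.mapDomain_apply two_mul_injective p.coeff n

theorem dbl_coeff_of_odd (p : ℂ[T;T⁻¹]) {k : ℤ} (hk : ¬ Even k) : (dbl p).coeff k = 0 := by
  refine Finsupp.mapDomain_of_notMem_range p.coeff k ?_
  rintro ⟨n, hn⟩
  exact hk ⟨n, by rw [← hn, ← two_mul]; rfl⟩

theorem dbl_injective : Function.Injective dbl := fun p q h => by
  ext n
  rw [← dbl_coeff_two_mul, h, dbl_coeff_two_mul]

theorem dbl_star (p : ℂ[T;T⁻¹]) : dbl (star p) = star (dbl p) := by
  ext k
  rw [star_coeff]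
  by_cases hk : Even k
  · obtain ⟨n, rfl⟩ := hk
    rw [← two_mul, dbl_coeff_two_mul, star_coeff, ← mul_neg, dbl_coeff_two_mul]
  · rw [dbl_coeff_of_odd p (by rwa [even_neg]), dbl_coeff_of_odd _ hk, star_zero]

theorem dbl_mem_coeffSubring {F : Subfield ℂ} {p : ℂ[T;T⁻¹]} (hp : p ∈ coeffSubring F) :
    dbl p ∈ coeffSubring F := by
  rw [mem_coeffSubring] at *
  intro k
  by_cases hk : Even k
  · obtain ⟨n, rfl⟩ := hk
    rw [← two_mul, dbl_coeff_two_mul]; exact hp n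
  · rw [dbl_coeff_of_odd p hk]; exact F.zero_mem

theorem dbl_coeff_symm {p : ℂ[T;T⁻¹]} {e : ℤˣ} {c : ℤ} (h : HasSym p e c) (k : ℤ) :
    (dbl p).coeff k = (e : ℤ) * (dbl p).coeff (2 * c - k) := by
  by_cases hk : Even k
  · obtain ⟨n, rfl⟩ := hk
    rw [← two_mul, ← mul_sub, dbl_coeff_two_mul, dbl_coeff_two_mul]
    exact hasSym_iff_coeff.1 h n
  · have h1 : ¬ Even (2 * c - k) := by
      intro h2; exact hk (by simpa [Int.even_sub] using h2)
    rw [dbl_coeff_of_odd p hk, dbl_coeff_of_odd p h1, mul_zero]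

/-- The inverse of the substitution `z = w²`, for Laurent polynomials in `w²`. -/
noncomputable def half (p : ℂ[T;T⁻¹]) : ℂ[T;T⁻¹] :=
  AddMonoidAlgebra.comapDomain (fun n : ℤ => 2 * n) two_mul_injective p

theorem half_coeff (p : ℂ[T;T⁻¹]) (n : ℤ) : (half p).coeff n = p.coeff (2 * n) := by
  simp [half]

theorem dbl_half {p : ℂ[T;T⁻¹]} (hp : ∀ k, ¬ Even k → p.coeff k = 0) : dbl (half p) = p := by
  ext k
  by_cases hk : Even k
  · obtain ⟨n, rfl⟩ := hk
    rw [← two_mul, dbl_coeff_two_mul, half_coeff]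
  · rw [dbl_coeff_of_odd _ hk, hp k hk]

theorem zpow_neg_one_eq_iff {a b : ℤ} : (-1 : ℂ) ^ a = (-1) ^ b ↔ Even (a - b) := by
  rw [← div_eq_one_iff_eq (zpow_ne_zero _ (by norm_num)), ← zpow_sub₀ (by norm_num)]
  rcases Int.even_or_odd (a - b) with h | h
  · simp [h, h.neg_one_zpow]
  · rw [h.neg_one_zpow]
    simp only [Int.not_even_iff_odd.2 h, iff_false]
    norm_num

section Monomials

variable {m n : Type*} [Fintype m] [Fintype n] [DecidableEq m] [DecidableEq n]

/-- The diagonal matrix of the monomials `w^(a_i)`. -/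
noncomputable def tdiag (a : m → ℤ) : LMat m m := Matrix.diagonal fun i => T (a i)

theorem tdiag_mul_conjTranspose (a : m → ℤ) : tdiag a * (tdiag a)ᴴ = 1 := by
  rw [tdiag, Matrix.diagonal_conjTranspose, Matrix.diagonal_mul_diagonal, ← Matrix.diagonal_one]
  congr 1
  funext i
  rw [Pi.star_apply, star_T, ← T_add, add_neg_cancel, T_zero]

theorem tdiag_mul_mul_apply (a : m → ℤ) (b : n → ℤ) (M : LMat m n) (i : m) (j : n) :
    (tdiag a * M * tdiag b) i j = T (a i + b j) * M i j := by
  rw [tdiag, tdiag, Matrix.mul_diagonal, Matrix.diagonal_mul, T_add]; ring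

omit [Fintype m] [Fintype n] [DecidableEq m] [DecidableEq n] in
theorem conjTranspose_map_dbl (M : LMat m n) : Mᴴ.map dbl = (M.map dbl)ᴴ := by
  ext i j : 2; simp [dbl_star]

omit [Fintype m] [Fintype n] [DecidableEq m] [DecidableEq n] in
theorem map_dbl_injective : Function.Injective fun M : LMat m n => M.map dbl :=
  Matrix.map_injective dbl_injective

omit [Fintype m] in
theorem map_dbl_one : (1 : LMat m m).map dbl = 1 := Matrix.map_one _ (map_zero _) (map_one _)

theorem mul_conjTranspose_of_dbl {M N : LMat m n} {a : m → ℤ} {b : n → ℤ}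
    (h : M.map dbl = tdiag a * N * tdiag b) :
    M * Mᴴ = 1 ↔ N * Nᴴ = 1 := by
  have ha := tdiag_mul_conjTranspose a
  have ha' := mul_eq_one_comm.1 ha
  have h1 : (M * Mᴴ).map dbl = tdiag a * (N * Nᴴ) * (tdiag a)ᴴ := by
    rw [Matrix.map_mul, conjTranspose_map_dbl, h, Matrix.conjTranspose_mul,
      Matrix.conjTranspose_mul]
    calc _ = tdiag a * N * (tdiag b * (tdiag b)ᴴ) * (Nᴴ * (tdiag a)ᴴ) := by
          simp only [Matrix.mul_assoc]
      _ = _ := by rw [tdiag_mul_conjTranspose, Matrix.mul_one]; simp only [Matrix.mul_assoc]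
  constructor
  · intro h2
    rw [h2, map_dbl_one] at h1
    calc N * Nᴴ = ((tdiag a)ᴴ * tdiag a) * (N * Nᴴ) * ((tdiag a)ᴴ * tdiag a) := by
          rw [ha', Matrix.one_mul, Matrix.mul_one]
      _ = (tdiag a)ᴴ * (tdiag a * (N * Nᴴ) * (tdiag a)ᴴ) * tdiag a := by
          simp only [Matrix.mul_assoc]
      _ = 1 := by rw [← h1, Matrix.mul_one, ha']
  · intro h2
    apply map_dbl_injective
    change (M * Mᴴ).map dbl = (1 : LMat m m).map dbl
    rw [h1, h2, Matrix.mul_one, ha, map_dbl_one]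

theorem conjTranspose_mul_of_dbl {M N : LMat m n} {a : m → ℤ} {b : n → ℤ}
    (h : M.map dbl = tdiag a * N * tdiag b) :
    (Mᴴ * M).map dbl = (tdiag b)ᴴ * (Nᴴ * N) * tdiag b := by
  rw [Matrix.map_mul, conjTranspose_map_dbl, h, Matrix.conjTranspose_mul,
    Matrix.conjTranspose_mul]
  calc _ = (tdiag b)ᴴ * Nᴴ * ((tdiag a)ᴴ * tdiag a) * (N * tdiag b) := by
        simp only [Matrix.mul_assoc]
    _ = _ := by
        rw [mul_eq_one_comm.1 (tdiag_mul_conjTranspose a), Matrix.mul_one]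
        simp only [Matrix.mul_assoc]

end Monomials

/-! ### Matrix extension with symmetry -/

section Extension

variable {ι κ n : Type*} [Fintype ι] [Fintype κ] [Fintype n] [DecidableEq ι] [DecidableEq κ]
  [DecidableEq n]

omit [Fintype n] [DecidableEq n] in
theorem cmat_diagonal_mul_apply {m : Type*} [Fintype m] [DecidableEq m] (v : m → ℂ) (M : LMat m n)
    (i : m) (j : n) (k : ℤ) :
    ((cmat (Matrix.diagonal v) * M) i j).coeff k = v i * (M i j).coeff k := by
  have := congrFun (congrFun (cf_cmat_mul k (Matrix.diagonal v) M) i) j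
  rw [Matrix.diagonal_mul] at this
  exact this

theorem mul_cmat_diagonal_apply {m : Type*} [Fintype m] [DecidableEq m] (v : n → ℂ) (M : LMat m n)
    (i : m) (j : n) (k : ℤ) :
    ((M * cmat (Matrix.diagonal v)) i j).coeff k = (M i j).coeff k * v j := by
  have := congrFun (congrFun (cf_mul_cmat k M (Matrix.diagonal v)) i) j
  rw [Matrix.mul_diagonal] at this
  exact this

theorem diagonal_neg_one_zpow_mul_self {m : Type*} [Fintype m] [DecidableEq m] (a : m → ℤ) :
    (Matrix.diagonal fun j => (-1 : ℂ) ^ a j) * (Matrix.diagonal fun j => (-1 : ℂ) ^ a j) = 1 := by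
  rw [Matrix.diagonal_mul_diagonal, ← Matrix.diagonal_one]
  congr 1; funext j
  rw [← mul_zpow]; norm_num

/-- Orthonormal rows `P` with compatible symmetry, of length at most `L_j` in column `j`, can be
completed by rows with compatible symmetry and the same bounds on the lengths. With `z = w²` and
multiplication by monomials in `w`, all centers of symmetry in column `j` move to the exponent
`L_j`; the parity of the exponents of `w` records from which powers of `z` an entry comes. -/
theorem exists_completion_of_hasSymPattern {F : Subfield ℂ}
    (hF : ∀ x ∈ F, (starRingEnd ℂ) x ∈ F)
    (hsqrt : ∀ y : ℝ, 0 < y → (y : ℂ) ∈ F → ((√y : ℝ) : ℂ) ∈ F)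
    (hcard : Fintype.card ι + Fintype.card κ = Fintype.card n) {P : LMat ι n}
    (hPF : CoeffsIn F P) (hP : P * Pᴴ = 1) {ρ : ι → ℤˣ × ℤ} {σ : n → ℤˣ × ℤ}
    (hsym : HasSymPattern P ρ σ) {L : n → ℤ} (hL : ∀ j, 0 ≤ L j)
    (hlen : ∀ i j, coeffLength (P i j) ≤ (L j : WithBot ℤ)) :
    ∃ (Q : LMat κ n) (ρ' : κ → ℤˣ × ℤ), CoeffsIn F Q ∧ Q * Qᴴ = 1 ∧ Pᴴ * P + Qᴴ * Q = 1 ∧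
      HasSymPattern Q ρ' σ ∧ ∀ i j, coeffLength (Q i j) ≤ (L j : WithBot ℤ) := by
  set b : n → ℤ := fun j => (σ j).2 - L j with hb
  -- the rows in the variable `w`
  set P' : LMat ι n := Matrix.of fun i j => T (-(ρ i).2 - b j) * dbl (P i j) with hP'
  have hPc : ∀ i j k, (P' i j).coeff k = (dbl (P i j)).coeff (k + (ρ i).2 + b j) := by
    intro i j k
    rw [hP', Matrix.of_apply, coeff_T_mul]
    congr 1; ring
  have hPP' : P.map dbl = tdiag (fun i => (ρ i).2) * P' * tdiag b := by
    ext i j : 2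
    rw [tdiag_mul_mul_apply, hP', Matrix.of_apply, ← mul_assoc, ← T_add]
    rw [show (ρ i).2 + b j + (-(ρ i).2 - b j) = 0 by ring, T_zero, one_mul, Matrix.map_apply]
  have hsym' : P'.map invert * reflMat (fun j => (σ j).1) L =
      cmat (Matrix.diagonal fun i => (((ρ i).1 : ℤ) : ℂ)) * P' := by
    ext i j k
    rw [coeff_mul_reflMat, cmat_diagonal_mul_apply, hPc, hPc, dbl_coeff_symm (hsym i j)]
    have h1 : 2 * ((ρ i).2 + (σ j).2) - (2 * L j - k + (ρ i).2 + b j) = k + (ρ i).2 + b j := by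
      simp only [hb]; ring
    rw [h1, Units.val_mul, ← mul_assoc, ← Int.cast_mul]
    congr 2
    rw [mul_comm, mul_assoc, Int.units_coe_mul_self, mul_one]
  have hR : ∀ v : ι → ℤˣ, cmat (Matrix.diagonal fun i => ((v i : ℤ) : ℂ)) *
      cmat (Matrix.diagonal fun i => ((v i : ℤ) : ℂ)) = 1 := fun v => by
    rw [← cmat_mul, Matrix.diagonal_mul_diagonal, ← cmat_one, ← Matrix.diagonal_one]
    congr 2; funext i
    rw [← Int.cast_mul, Int.units_coe_mul_self, Int.cast_one]
  have hneg : P'.map negSubst * cmat (Matrix.diagonal fun j => (-1 : ℂ) ^ b j) =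
      cmat (Matrix.diagonal fun i => (-1 : ℂ) ^ (ρ i).2) * P' := by
    ext i j k
    rw [mul_cmat_diagonal_apply, cmat_diagonal_mul_apply, Matrix.map_apply, negSubst_coeff, hPc]
    by_cases hk : Even (k + (ρ i).2 + b j)
    · have h1 : (-1 : ℂ) ^ (k + b j) = (-1 : ℂ) ^ (ρ i).2 :=
        zpow_neg_one_eq_iff.2 (by
          rw [show k + b j - (ρ i).2 = k + (ρ i).2 + b j - 2 * (ρ i).2 by ring]
          exact hk.sub (even_two_mul _))
      rw [← h1, zpow_add₀ (by norm_num)]; ring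
    · rw [dbl_coeff_of_odd _ hk]; simp
  have hP0 : LowerBound 0 P' := fun k hk => by
    ext i j
    change (P' i j).coeff k = 0
    by_contra hne
    rw [hPc] at hne
    have h1 : Even (k + (ρ i).2 + b j) := by
      by_contra h; exact hne (dbl_coeff_of_odd _ h)
    obtain ⟨m, hm⟩ := h1
    rw [hm, ← two_mul, dbl_coeff_two_mul] at hne
    have h2 := hne
    rw [hasSym_iff_coeff.1 (hsym i j) m] at h2
    have h3 := sub_le_of_coeffLength_le (hlen i j) (right_ne_zero_of_mul h2) hne
    simp only [hb] at hm
    omega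
  have hPL : LowerBound 0 (P'.map invert * reflMat (fun j => (σ j).1) L) := by
    rw [hsym']; simpa using (lowerBound_cmat _).mul hP0
  obtain ⟨Q', δ, θ, hQF, hQ, hPQ, hQ0, hQδ, hQθ⟩ := exists_symmetric_completion (κ := κ) hF hsqrt
    hcard (P := P') (s := fun j => (σ j).1) (L := L)
    (S := Matrix.diagonal fun j => (-1 : ℂ) ^ b j)
    (R := Matrix.diagonal fun i => (((ρ i).1 : ℤ) : ℂ))
    (R' := Matrix.diagonal fun i => (-1 : ℂ) ^ (ρ i).2)
    (fun i j => Subring.mul_mem _ (T_mem_coeffSubring _)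
      (dbl_mem_coeffSubring (mem_coeffSubring.2 (hPF i j))))
    ((mul_conjTranspose_of_dbl hPP').1 hP) hP0 hL hPL
    (fun i j => by
      rw [Matrix.diagonal_apply]; split_ifs
      · exact zpow_mem (neg_mem F.one_mem) _
      · exact F.zero_mem)
    (by
      rw [Matrix.diagonal_conjTranspose]
      congr 1; funext j; exact star_neg_one_zpow _)
    (diagonal_neg_one_zpow_mul_self b)
    (by
      rw [cmat, Matrix.diagonal_map (map_zero _), reflMat, Matrix.diagonal_mul_diagonal,
        Matrix.diagonal_mul_diagonal]
      congr 1; funext j; exact mul_comm _ _)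
    (by rw [hsym', ← Matrix.mul_assoc, hR, Matrix.one_mul])
    (by rw [hneg, ← Matrix.mul_assoc, ← cmat_mul, diagonal_neg_one_zpow_mul_self, cmat_one,
      Matrix.one_mul])
  -- back to the variable `z`
  set e : κ → ℤ := fun i => if θ i = 1 then 0 else 1 with he
  have hθ : ∀ i, ((θ i : ℤ) : ℂ) = (-1) ^ e i := fun i => by
    rcases Int.units_eq_one_or (θ i) with h | h <;> simp [he, h]
  have hev : ∀ i j k, (Q' i j).coeff k ≠ 0 → Even (k + e i + b j) := by
    intro i j k hk
    have h1 := congrArg (fun p => p.coeff k) (congrFun (congrFun hQθ i) j)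
    simp only [mul_cmat_diagonal_apply, cmat_diagonal_mul_apply, Matrix.map_apply, negSubst_coeff,
      hθ] at h1
    have h2 : (-1 : ℂ) ^ (k + b j) = (-1) ^ e i := by
      rw [zpow_add₀ (by norm_num)]
      exact mul_right_cancel₀ hk (by rw [← h1]; ring)
    have h3 := zpow_neg_one_eq_iff.1 h2
    rw [show k + e i + b j = k + b j - e i + 2 * e i by ring]
    exact h3.add (even_two_mul _)
  have hsymQ : ∀ i j k, ((σ j).1 : ℤ) * (Q' i j).coeff (2 * L j - k) =
      (δ i : ℤ) * (Q' i j).coeff k := by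
    intro i j k
    have h1 := congrArg (fun p => p.coeff k) (congrFun (congrFun hQδ i) j)
    simpa only [coeff_mul_reflMat, cmat_diagonal_mul_apply] using h1
  set Q : LMat κ n := Matrix.of fun i j => half (T (e i + b j) * Q' i j) with hQdef
  have hQQ' : Q.map dbl = tdiag e * Q' * tdiag b := by
    ext i j : 2
    rw [tdiag_mul_mul_apply, hQdef, Matrix.map_apply, Matrix.of_apply, dbl_half]
    intro k hk
    rw [coeff_T_mul]
    by_contra hne
    refine hk ?_
    have := hev i j _ hne
    rwa [show k - (e i + b j) + e i + b j = k by ring] at this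
  have hQc : ∀ i j m, (Q i j).coeff m = (Q' i j).coeff (2 * m - e i - b j) := by
    intro i j m
    rw [hQdef, Matrix.of_apply, half_coeff, coeff_T_mul]
    congr 1; ring
  refine ⟨Q, fun i => (δ i, e i), ?_, (mul_conjTranspose_of_dbl hQQ').2 hQ, ?_, ?_, ?_⟩
  · intro i j k
    rw [hQc]
    exact mem_coeffSubring.1 (hQF i j) _
  · apply map_dbl_injective
    change (Pᴴ * P + Qᴴ * Q).map dbl = (1 : LMat n n).map dbl
    rw [Matrix.map_add _ (map_add dbl), conjTranspose_mul_of_dbl hPP',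
      conjTranspose_mul_of_dbl hQQ', ← Matrix.add_mul, ← Matrix.mul_add, hPQ, Matrix.mul_one,
      mul_eq_one_comm.1 (tdiag_mul_conjTranspose b), map_dbl_one]
  · intro i j
    refine hasSym_iff_coeff.2 fun m => ?_
    rw [hQc, hQc]
    have h1 := hsymQ i j (2 * m - e i - b j)
    have h2 : 2 * L j - (2 * m - e i - b j) =
        2 * (((fun i => (δ i, e i)) i).2 + (σ j).2 - m) - e i - b j := by
      simp only [hb]; ring
    rw [h2] at h1
    have h3 : ((δ i : ℤ) : ℂ) * ((δ i : ℤ) : ℂ) = 1 := by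
      rw [← Int.cast_mul, Int.units_coe_mul_self, Int.cast_one]
    calc _ = (((δ i : ℤ) : ℂ) * ((δ i : ℤ) : ℂ)) * (Q' i j).coeff (2 * m - e i - b j) := by
          rw [h3, one_mul]
      _ = ((δ i : ℤ) : ℂ) * (((σ j).1 : ℤ) *
          (Q' i j).coeff (2 * ((e i) + (σ j).2 - m) - e i - b j)) := by rw [h1, mul_assoc]
      _ = _ := by push_cast; ring
  · intro i j
    have hbd : ∀ m, (Q i j).coeff m ≠ 0 → 0 ≤ 2 * m - e i - b j ∧ 2 * m - e i - b j ≤ 2 * L j := by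
      intro m hm
      rw [hQc] at hm
      constructor
      · by_contra h
        exact hm (hQ0.entry i j (by omega))
      · by_contra h
        have h1 := hsymQ i j (2 * m - e i - b j)
        rw [hQ0.entry i j (by omega), mul_zero] at h1
        exact (mul_ne_zero (by simp) hm) h1.symm
    refine finsetLength_le fun x hx y hy => ?_
    have h1 := hbd x (Finsupp.mem_support_iff.1 hx)
    have h2 := hbd y (Finsupp.mem_support_iff.1 hy)
    omega

end Extension

theorem exists_int_eq_max_zero_sup {ι : Type*} (s : Finset ι) (f : ι → WithBot ℤ) :
    ∃ L : ℤ, 0 ≤ L ∧ (L : WithBot ℤ) = max 0 (s.sup f) := by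
  have h0 : (0 : WithBot ℤ) ≤ max 0 (s.sup f) := le_max_left _ _
  cases h : max 0 (s.sup f) with
  | bot => rw [h] at h0; exact absurd h0 (by decide)
  | coe L =>
    rw [h] at h0
    exact ⟨L, by exact_mod_cast h0, rfl⟩

theorem exists_extend_first_block {d : ℕ} [NeZero d] {α β : Type*} (f : α → β)
    (g : {p : Fin d × α // p.1 ≠ 0} → β) :
    ∃ h : Fin d × α → β, (∀ l, h (0, l) = f l) ∧ ∀ p (hp : p.1 ≠ 0), h p = g ⟨p, hp⟩ :=
  ⟨fun p => if hp : p.1 = 0 then f p.2 else g ⟨p, hp⟩, fun _ => dif_pos rfl,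
    fun _ hp => dif_neg hp⟩

/-- A matrix of `r` orthonormal rows with compatible symmetry is the first block row of a
paraunitary matrix with compatible symmetry, and the lengths of the coefficient supports do not
grow. -/
theorem exists_isSymExtension {F : Subfield ℂ}
    (hF : ∀ x ∈ F, (starRingEnd ℂ) x ∈ F)
    (hsqrt : ∀ y : ℝ, 0 < y → (y : ℂ) ∈ F → ((√y : ℝ) : ℂ) ∈ F)
    {r d : ℕ} [NeZero d] {P : LMat (Fin r) (Fin d × Fin r)} (hPF : CoeffsIn F P)
    (hP : IsParaunitary P) {ρ : Fin r → ℤˣ × ℤ} {σ : Fin d × Fin r → ℤˣ × ℤ}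
    (hsym : HasSymPattern P ρ σ) :
    ∃ Pe E K, IsSymExtension F P ρ σ Pe E K ∧ ∀ p q, coeffLength (Pe p q) ≤
      max 0 (Finset.univ.sup fun l : Fin r => coeffLength (P l q)) := by
  choose L hL0 hL using fun q =>
    exists_int_eq_max_zero_sup Finset.univ fun l : Fin r => coeffLength (P l q)
  have hlen : ∀ l q, coeffLength (P l q) ≤ (L q : WithBot ℤ) := fun l q => by
    rw [hL]
    exact le_max_of_le_right
      (Finset.le_sup (f := fun l : Fin r => coeffLength (P l q)) (Finset.mem_univ l))
  obtain ⟨e, he⟩ : ∃ e : Fin r ≃ {p : Fin d × Fin r // p.1 = 0}, ∀ l, (e l).1 = (0, l) :=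
    ⟨{ toFun := fun l => ⟨(0, l), rfl⟩
       invFun := fun p => p.1.2
       left_inv := fun _ => rfl
       right_inv := fun p => Subtype.ext (Prod.ext p.2.symm rfl) }, fun _ => rfl⟩
  have hcard : Fintype.card (Fin r) + Fintype.card {p : Fin d × Fin r // p.1 ≠ 0} =
      Fintype.card (Fin d × Fin r) := by
    rw [Fintype.card_congr e, Fintype.card_subtype_compl]
    have := Fintype.card_subtype_le fun p : Fin d × Fin r => p.1 = 0
    omega
  obtain ⟨Q, ρ', hQF, hQ, hPQ, hQsym, hQlen⟩ :=
    exists_completion_of_hasSymPattern hF hsqrt hcard hPF hP hsym hL0 hlen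
  obtain ⟨Pe, h0, h1⟩ : ∃ Pe : LMat (Fin d × Fin r) (Fin d × Fin r),
      (∀ l, Pe (0, l) = P l) ∧ ∀ (p : Fin d × Fin r) (hp : p.1 ≠ 0), Pe p = Q ⟨p, hp⟩ :=
    exists_extend_first_block P Q
  obtain ⟨ρe, hρ0, hρ1⟩ := exists_extend_first_block ρ ρ'
  have hPHP : Peᴴ * Pe = 1 := by
    rw [← hPQ]
    refine Matrix.ext fun i j => ?_
    simp only [Matrix.mul_apply, Matrix.add_apply, Matrix.conjTranspose_apply]
    rw [← Fintype.sum_subtype_add_sum_subtype (fun p : Fin d × Fin r => p.1 = 0), ← e.sum_comp]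
    congr 1
    · exact Finset.sum_congr rfl fun l _ => by rw [he, h0]
    · exact Finset.sum_congr rfl fun p _ => by rw [h1 p.1 p.2]
  have hP' : ∀ p : Fin d × Fin r, (∃ l, p = ((0 : Fin d), l)) ∨ p.1 ≠ 0 := by
    rintro ⟨m, l⟩
    by_cases h : m = 0
    · exact Or.inl ⟨l, by rw [h]⟩
    · exact Or.inr h
  refine ⟨Pe, fun p => (ρe p).1, fun p => (ρe p).2, ⟨?_, fun l q => by rw [h0], ?_, hρ0, ?_⟩, ?_⟩
  · intro p q
    rcases hP' p with ⟨l, rfl⟩ | h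
    · rw [h0]; exact hPF l q
    · rw [h1 p h]; exact hQF _ q
  · exact mul_eq_one_comm.1 hPHP
  · intro p q
    rcases hP' p with ⟨l, rfl⟩ | h
    · simpa only [h0, hρ0] using hsym l q
    · simpa only [h1 p h, hρ1 p h] using hQsym _ q
  · intro p q
    rw [← hL]
    rcases hP' p with ⟨l, rfl⟩ | h
    · rw [h0]; exact hlen l q
    · rw [h1 p h]; exact hQlen _ q

/-! ### Reflection of the subsymbols -/

section Reflection

variable {r d : ℕ} [NeZero d] {c : Fin r → ℝ}

theorem sub_eq_mul_reflQuot_add_reflIdx (hc : ∀ l j, ∃ n : ℤ, (n : ℝ) = d * c l - c j)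
    {l j : Fin r} {n : ℤ} (hn : (n : ℝ) = d * c l - c j) (γ : Fin d) :
    n - (γ : ℕ) = d * reflQuot d c l j γ + (reflIdx d c j γ : ℕ) := by
  have h := reflRem_spec d c l j γ n hn
  rw [reflRem_indep d c hc l j j γ, ← hn] at h
  exact_mod_cast h

theorem Int.eq_and_eq_of_mul_add_eq {d : ℕ} {R R' : ℤ} {a b : Fin d}
    (h : d * R + (a : ℕ) = d * R' + (b : ℕ)) : R = R' ∧ a = b := by
  have hd : (0 : ℤ) < d := by have := a.2; omega
  have h1 := congrArg (· / (d : ℤ)) h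
  simp only [Int.mul_add_ediv_left _ _ hd.ne'] at h1
  rw [Int.ediv_eq_zero_of_lt (by omega) (by have := a.2; omega),
    Int.ediv_eq_zero_of_lt (by omega) (by have := b.2; omega), add_zero, add_zero] at h1
  subst h1
  exact ⟨rfl, Fin.ext (by omega)⟩

theorem reflIdx_reflQuot_reflIdx (hc : ∀ l j, ∃ n : ℤ, (n : ℝ) = d * c l - c j)
    (l j : Fin r) (γ : Fin d) :
    reflQuot d c l j (reflIdx d c j γ) = reflQuot d c l j γ ∧
      reflIdx d c j (reflIdx d c j γ) = γ := by
  obtain ⟨n, hn⟩ := hc l j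
  have h1 := sub_eq_mul_reflQuot_add_reflIdx hc hn γ
  have h2 := sub_eq_mul_reflQuot_add_reflIdx hc hn (reflIdx d c j γ)
  exact Int.eq_and_eq_of_mul_add_eq (by linarith)

theorem reflIdx_reflIdx (hc : ∀ l j, ∃ n : ℤ, (n : ℝ) = d * c l - c j) (j : Fin r) (γ : Fin d) :
    reflIdx d c j (reflIdx d c j γ) = γ :=
  (reflIdx_reflQuot_reflIdx hc j j γ).2

theorem reflQuot_reflIdx (hc : ∀ l j, ∃ n : ℤ, (n : ℝ) = d * c l - c j) (l j : Fin r)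
    (γ : Fin d) : reflQuot d c l j (reflIdx d c j γ) = reflQuot d c l j γ :=
  (reflIdx_reflQuot_reflIdx hc l j γ).1

/-- The quotients in two rows `l` and `l'` differ by `c_l - c_{l'}`, whatever `j` and `γ`; this is
why `R_{l,j}^γ + κ_{j,γ}` splits as `k_l + t_{γ,j}`. -/
theorem reflQuot_sub_reflQuot (hc : ∀ l j, ∃ n : ℤ, (n : ℝ) = d * c l - c j) (l l' j : Fin r)
    (γ : Fin d) : ((reflQuot d c l j γ - reflQuot d c l' j γ : ℤ) : ℝ) = c l - c l' := by
  obtain ⟨n, hn⟩ := hc l j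
  obtain ⟨n', hn'⟩ := hc l' j
  have h1 := sub_eq_mul_reflQuot_add_reflIdx hc hn γ
  have h2 := sub_eq_mul_reflQuot_add_reflIdx hc hn' γ
  have h3 : n - n' = d * (reflQuot d c l j γ - reflQuot d c l' j γ) := by linarith
  have h4 : (n : ℝ) - n' = d * ((reflQuot d c l j γ - reflQuot d c l' j γ : ℤ) : ℝ) := by
    exact_mod_cast h3
  rw [hn, hn'] at h4
  have hd : (d : ℝ) ≠ 0 := by exact_mod_cast NeZero.ne d
  exact mul_left_cancel₀ hd (by linarith)

theorem exists_isExponentSplit (hc : ∀ l j, ∃ n : ℤ, (n : ℝ) = d * c l - c j)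
    (κ : Fin r → Fin d → ℤ) : ∃ k t, IsExponentSplit d c κ k t := by
  rcases isEmpty_or_nonempty (Fin r) with h | ⟨⟨l₀⟩⟩
  · exact ⟨0, 0, fun l => h.elim l⟩
  · refine ⟨fun l => reflQuot d c l l₀ 0 - reflQuot d c l₀ l₀ 0,
      fun q => reflQuot d c l₀ q.2 q.1 + κ q.2 q.1, fun l j γ => ?_⟩
    have h : reflQuot d c l l₀ 0 - reflQuot d c l₀ l₀ 0 =
        reflQuot d c l j γ - reflQuot d c l₀ j γ := by
      have := (reflQuot_sub_reflQuot hc l l₀ l₀ 0).trans (reflQuot_sub_reflQuot hc l l₀ j γ).symm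
      exact_mod_cast this
    linarith

theorem subsymbol_coeff (a : LMat (Fin r) (Fin r)) (γ : ℤ) (l j : Fin r) (k : ℤ) :
    (subsymbol d a γ l j).coeff k = ((√(d : ℝ) : ℝ) : ℂ) * (a l j).coeff (γ + d * k) := by
  rw [subsymbol, Matrix.of_apply, coeff_C_mul]
  simp

theorem sqrt_natCast_ne_zero : ((√(d : ℝ) : ℝ) : ℂ) ≠ 0 := by
  have : (0 : ℝ) < d := by exact_mod_cast Nat.pos_of_ne_zero (NeZero.ne d)
  exact_mod_cast (Real.sqrt_pos.2 this).ne'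

theorem exists_eq_add_mul (n : ℤ) : ∃ (γ : Fin d) (k : ℤ), n = (γ : ℕ) + d * k := by
  have hd : 0 < (d : ℤ) := by exact_mod_cast Nat.pos_of_ne_zero (NeZero.ne d)
  have h1 := Int.emod_nonneg n hd.ne'
  have h2 := Int.emod_lt_of_pos n hd
  exact ⟨⟨(n % d).toNat, by omega⟩, n / d, by
    simp only [Int.toNat_of_nonneg h1, Int.emod_add_mul_ediv]⟩

/-- An entry of a filter is symmetric if and only if its subsymbols are reflected into each
other. -/
theorem hasSym_iff_subsymbol_coeff {a : LMat (Fin r) (Fin r)} {l j : Fin r} {e : ℤˣ} {N : ℤ}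
    {R : Fin d → ℤ} {Q : Fin d → Fin d} (h : ∀ γ : Fin d, N - (γ : ℕ) = d * R γ + (Q γ : ℕ)) :
    HasSym (a l j) e N ↔ ∀ (γ : Fin d) (k : ℤ), (subsymbol d a (γ : ℕ) l j).coeff k =
      (e : ℤ) * (subsymbol d a (Q γ : ℕ) l j).coeff (R γ - k) := by
  have h1 : ∀ (γ : Fin d) (k : ℤ), N - ((γ : ℕ) + d * k) = (Q γ : ℕ) + d * (R γ - k) :=
    fun γ k => by linarith [h γ]
  rw [hasSym_iff_coeff]
  constructor
  · intro hs γ k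
    rw [subsymbol_coeff, subsymbol_coeff, hs, h1]; ring
  · intro hs n
    obtain ⟨γ, k, rfl⟩ := exists_eq_add_mul (d := d) n
    have h2 := hs γ k
    rw [subsymbol_coeff, subsymbol_coeff] at h2
    rw [h1]
    exact mul_left_cancel₀ (sqrt_natCast_ne_zero (d := d)) (by rw [h2]; ring)

end Reflection

/-! ### The symmetrizing matrix -/

section Symmetrizer

variable {r d : ℕ} [NeZero d] {c : Fin r → ℝ} {κ : Fin r → Fin d → ℤ}

/-- The involution `(γ, j) ↦ (Q_j^γ, j)` of the columns. -/
noncomputable def reflCol (d : ℕ) [NeZero d] (c : Fin r → ℝ) (q : Fin d × Fin r) : Fin d × Fin r :=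
  (reflIdx d c q.2 q.1, q.2)

theorem reflCol_reflCol (hc : ∀ l j, ∃ n : ℤ, (n : ℝ) = d * c l - c j) (q : Fin d × Fin r) :
    reflCol d c (reflCol d c q) = q :=
  Prod.ext (reflIdx_reflIdx hc q.2 q.1) rfl

/-- The diagonal entry of `U` in column `q`. -/
noncomputable def symmetrizerDiag (d : ℕ) [NeZero d] (c : Fin r → ℝ) (q : Fin d × Fin r) :
    ℂ[T;T⁻¹] :=
  if q.1 = reflIdx d c q.2 q.1 then 1 else C (((√2 : ℝ) : ℂ)⁻¹)

/-- The entry of `U` in column `q` and the row to which `q` is reflected, or `0` if `q` is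
fixed. -/
noncomputable def symmetrizerOffDiag (d : ℕ) [NeZero d] (c : Fin r → ℝ) (κ : Fin r → Fin d → ℤ)
    (q : Fin d × Fin r) : ℂ[T;T⁻¹] :=
  if q.1 = reflIdx d c q.2 q.1 then 0
  else C (((√2 : ℝ) : ℂ)⁻¹ * ((reflSign d c q.2 q.1 : ℤ) : ℂ)) * T (κ q.2 q.1)

theorem symmetrizer_apply (p q : Fin d × Fin r) :
    symmetrizer d c κ p q = (if p = q then symmetrizerDiag d c q else 0) +
      (if p = reflCol d c q then symmetrizerOffDiag d c κ q else 0) := by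
  rw [symmetrizer, Matrix.of_apply, symmetrizerDiag, symmetrizerOffDiag, reflSign, reflCol]
  dsimp only
  by_cases h : q.1 = reflIdx d c q.2 q.1
  · simp only [if_pos h, ite_self, add_zero]
  · rcases lt_or_gt_of_ne h with h1 | h1
    · simp only [if_neg h, if_pos h1, if_pos h1.le, mul_add, mul_ite, mul_one, mul_zero]
      simp
    · simp only [if_neg h, if_neg h1.not_gt, if_neg h1.not_ge]
      split_ifs <;> simp [mul_add, sub_eq_add_neg]

theorem mul_symmetrizer_apply {m : Type*} (A : LMat m (Fin d × Fin r)) (i : m)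
    (q : Fin d × Fin r) : (A * symmetrizer d c κ) i q =
      A i q * symmetrizerDiag d c q + A i (reflCol d c q) * symmetrizerOffDiag d c κ q := by
  simp [Matrix.mul_apply, symmetrizer_apply, mul_add, Finset.sum_add_distrib]

theorem mul_symmetrizer_conjTranspose_apply (hc : ∀ l j, ∃ n : ℤ, (n : ℝ) = d * c l - c j)
    {m : Type*} (A : LMat m (Fin d × Fin r)) (i : m) (p : Fin d × Fin r) :
    (A * (symmetrizer d c κ)ᴴ) i p = A i p * star (symmetrizerDiag d c p) +
      A i (reflCol d c p) * star (symmetrizerOffDiag d c κ (reflCol d c p)) := by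
  have h : ∀ q, p = reflCol d c q ↔ reflCol d c p = q := fun q =>
    ⟨fun h => by rw [h, reflCol_reflCol hc], fun h => by rw [← h, reflCol_reflCol hc]⟩
  simp only [Matrix.mul_apply, Matrix.conjTranspose_apply, symmetrizer_apply, star_add, mul_add,
    Finset.sum_add_distrib, h, apply_ite star, star_zero, mul_ite, mul_zero,
    Finset.sum_ite_eq, Finset.mem_univ, if_true]

theorem inv_sqrt_two_mul_self : ((√2 : ℝ) : ℂ)⁻¹ * ((√2 : ℝ) : ℂ)⁻¹ = 2⁻¹ := by
  rw [← mul_inv, ← Complex.ofReal_mul, Real.mul_self_sqrt (by norm_num), Complex.ofReal_ofNat]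

theorem star_inv_sqrt_two : star (((√2 : ℝ) : ℂ)⁻¹) = ((√2 : ℝ) : ℂ)⁻¹ := by
  rw [star_inv₀]; congr 1; exact Complex.conj_ofReal _

theorem reflCol_eq_self {q : Fin d × Fin r} (h : q.1 = reflIdx d c q.2 q.1) :
    reflCol d c q = q :=
  Prod.ext h.symm rfl

theorem reflCol_ne_reflIdx (hc : ∀ l j, ∃ n : ℤ, (n : ℝ) = d * c l - c j) {q : Fin d × Fin r}
    (h : q.1 ≠ reflIdx d c q.2 q.1) :
    (reflCol d c q).1 ≠ reflIdx d c (reflCol d c q).2 (reflCol d c q).1 := fun h2 =>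
  h ((reflIdx_reflIdx hc q.2 q.1).symm.trans h2.symm)

theorem reflSign_reflCol (hc : ∀ l j, ∃ n : ℤ, (n : ℝ) = d * c l - c j) {q : Fin d × Fin r}
    (h : q.1 ≠ reflIdx d c q.2 q.1) :
    reflSign d c (reflCol d c q).2 (reflCol d c q).1 = -reflSign d c q.2 q.1 := by
  simp only [reflSign, reflCol, reflIdx_reflIdx hc]
  rcases lt_or_gt_of_ne h with h4 | h4
  · simp [h4.le, h4.not_ge]
  · simp [h4.le, h4.not_ge]

theorem star_symmetrizerDiag (q : Fin d × Fin r) :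
    star (symmetrizerDiag d c q) = symmetrizerDiag d c q := by
  rw [symmetrizerDiag]
  split_ifs
  · exact star_one _
  · rw [star_C, star_inv_sqrt_two]

theorem star_symmetrizerOffDiag_reflCol (hc : ∀ l j, ∃ n : ℤ, (n : ℝ) = d * c l - c j)
    (hκ : IsShift d c κ) (q : Fin d × Fin r) :
    star (symmetrizerOffDiag d c κ (reflCol d c q)) = -symmetrizerOffDiag d c κ q := by
  by_cases h : q.1 = reflIdx d c q.2 q.1
  · rw [reflCol_eq_self h, symmetrizerOffDiag, if_pos h, star_zero, neg_zero]
  · rw [symmetrizerOffDiag, symmetrizerOffDiag, if_neg h, if_neg (reflCol_ne_reflIdx hc h),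
      reflSign_reflCol hc h, star_mul', star_C, star_T, star_mul', star_inv_sqrt_two,
      show κ (reflCol d c q).2 (reflCol d c q).1 = -κ q.2 q.1 from hκ q.2 q.1, neg_neg,
      star_intCast]
    simp

theorem isParaunitary_symmetrizer (hc : ∀ l j, ∃ n : ℤ, (n : ℝ) = d * c l - c j)
    (hκ : IsShift d c κ) : IsParaunitary (symmetrizer d c κ) := by
  have h0 : ∀ p, symmetrizerDiag d c (reflCol d c p) = symmetrizerDiag d c p := fun p => by
    by_cases h : p.1 = reflIdx d c p.2 p.1
    · rw [reflCol_eq_self h]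
    · rw [symmetrizerDiag, symmetrizerDiag, if_neg h, if_neg (reflCol_ne_reflIdx hc h)]
  have h1 : ∀ p, symmetrizerDiag d c p * symmetrizerDiag d c p -
      symmetrizerOffDiag d c κ (reflCol d c p) * symmetrizerOffDiag d c κ p = 1 := by
    intro p
    by_cases h : p.1 = reflIdx d c p.2 p.1
    · simp [reflCol_eq_self h, symmetrizerDiag, symmetrizerOffDiag, if_pos h]
    · rw [symmetrizerDiag, symmetrizerOffDiag, symmetrizerOffDiag, if_neg h, if_neg h,
        if_neg (reflCol_ne_reflIdx hc h), reflSign_reflCol hc h,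
        show κ (reflCol d c p).2 (reflCol d c p).1 = -κ p.2 p.1 from hκ p.2 p.1,
        mul_mul_mul_comm, ← T_add, neg_add_cancel, T_zero, mul_one, ← map_mul, ← map_mul,
        ← map_sub, mul_mul_mul_comm, inv_sqrt_two_mul_self, ← Int.cast_mul, Units.val_neg,
        neg_mul, Int.units_coe_mul_self]
      norm_num
  change symmetrizer d c κ * (symmetrizer d c κ)ᴴ = 1
  refine Matrix.ext fun l p => ?_
  rw [mul_symmetrizer_conjTranspose_apply hc, symmetrizer_apply, symmetrizer_apply,
    reflCol_reflCol hc, Matrix.one_apply, star_symmetrizerDiag,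
    star_symmetrizerOffDiag_reflCol hc hκ, h0]
  have h3 := h1 p
  split_ifs with h5 h6 h6
  · linear_combination h3
  · linear_combination h3
  · ring
  · ring

theorem mul_symmetrizer_conjTranspose_apply_of_isShift
    (hc : ∀ l j, ∃ n : ℤ, (n : ℝ) = d * c l - c j) (hκ : IsShift d c κ) {m : Type*}
    (A : LMat m (Fin d × Fin r)) (i : m) (p : Fin d × Fin r) :
    (A * (symmetrizer d c κ)ᴴ) i p =
      A i p * symmetrizerDiag d c p - A i (reflCol d c p) * symmetrizerOffDiag d c κ p := by
  rw [mul_symmetrizer_conjTranspose_apply hc, star_symmetrizerDiag,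
    star_symmetrizerOffDiag_reflCol hc hκ, mul_neg, sub_eq_add_neg]

theorem coeff_mul_symmetrizerDiag {q : Fin d × Fin r} (h : q.1 ≠ reflIdx d c q.2 q.1)
    (p : ℂ[T;T⁻¹]) (n : ℤ) :
    (p * symmetrizerDiag d c q).coeff n = ((√2 : ℝ) : ℂ)⁻¹ * p.coeff n := by
  rw [symmetrizerDiag, if_neg h, mul_comm, coeff_C_mul]

theorem coeff_mul_symmetrizerOffDiag {q : Fin d × Fin r} (h : q.1 ≠ reflIdx d c q.2 q.1)
    (p : ℂ[T;T⁻¹]) (n : ℤ) : (p * symmetrizerOffDiag d c κ q).coeff n =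
      ((√2 : ℝ) : ℂ)⁻¹ * ((reflSign d c q.2 q.1 : ℤ) : ℂ) * p.coeff (n - κ q.2 q.1) := by
  rw [symmetrizerOffDiag, if_neg h, mul_comm, mul_assoc, coeff_C_mul, coeff_T_mul]

theorem shift_eq_zero (hκ : IsShift d c κ) {q : Fin d × Fin r}
    (h : q.1 = reflIdx d c q.2 q.1) : κ q.2 q.1 = 0 := by
  have h1 := hκ q.2 q.1
  rw [← h] at h1
  omega

theorem units_cast_mul_self (g : ℤˣ) : ((g : ℤ) : ℂ) * ((g : ℤ) : ℂ) = 1 := by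
  rw [← Int.cast_mul, Int.units_coe_mul_self, Int.cast_one]

/-- If the columns of `A` are reflected into each other, then those of `A U` are symmetric. -/
theorem hasSym_mul_symmetrizer (hκ : IsShift d c κ) {m : Type*} {A : LMat m (Fin d × Fin r)}
    {i : m} {e : ℤˣ} {q : Fin d × Fin r} {S : ℤ}
    (hA : ∀ n, (A i q).coeff n = (e : ℤ) * (A i (reflCol d c q)).coeff (S - n)) :
    HasSym ((A * symmetrizer d c κ) i q) (e * reflSign d c q.2 q.1) (S + κ q.2 q.1) := by
  rw [hasSym_iff_coeff, mul_symmetrizer_apply]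
  intro n
  by_cases h : q.1 = reflIdx d c q.2 q.1
  · rw [symmetrizerDiag, symmetrizerOffDiag, if_pos h, if_pos h, mul_one, mul_zero, add_zero,
      shift_eq_zero hκ h, reflSign, if_pos h.le, mul_one, add_zero]
    rw [reflCol_eq_self h] at hA
    exact hA n
  · simp only [AddMonoidAlgebra.coeff_add, Finsupp.add_apply, coeff_mul_symmetrizerDiag h,
      coeff_mul_symmetrizerOffDiag h, hA, Units.val_mul, Int.cast_mul]
    rw [show S - (S + κ q.2 q.1 - n) = n - κ q.2 q.1 by ring,
      show S + κ q.2 q.1 - n - κ q.2 q.1 = S - n by ring]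
    linear_combination -(((√2 : ℝ) : ℂ)⁻¹ * ((e : ℤ) : ℂ) * (A i (reflCol d c q)).coeff (S - n)) *
        units_cast_mul_self (reflSign d c q.2 q.1) -
      (((√2 : ℝ) : ℂ)⁻¹ * ((reflSign d c q.2 q.1 : ℤ) : ℂ) *
        (A i (reflCol d c q)).coeff (n - κ q.2 q.1)) * units_cast_mul_self e

/-- If the columns of `A` are symmetric, then those of `A U*` are reflected into each other. -/
theorem coeff_mul_symmetrizer_conjTranspose (hc : ∀ l j, ∃ n : ℤ, (n : ℝ) = d * c l - c j)
    (hκ : IsShift d c κ) {m : Type*} {A : LMat m (Fin d × Fin r)} {i : m} {e : ℤˣ}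
    {q : Fin d × Fin r} {S : ℤ}
    (hA : HasSym (A i q) (e * reflSign d c q.2 q.1) (S + κ q.2 q.1))
    (hA' : HasSym (A i (reflCol d c q))
      (e * reflSign d c (reflCol d c q).2 (reflCol d c q).1)
      (S + κ (reflCol d c q).2 (reflCol d c q).1)) (n : ℤ) :
    ((A * (symmetrizer d c κ)ᴴ) i q).coeff n =
      (e : ℤ) * ((A * (symmetrizer d c κ)ᴴ) i (reflCol d c q)).coeff (S - n) := by
  rw [mul_symmetrizer_conjTranspose_apply_of_isShift hc hκ,
    mul_symmetrizer_conjTranspose_apply_of_isShift hc hκ, reflCol_reflCol hc]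
  by_cases h : q.1 = reflIdx d c q.2 q.1
  · rw [reflCol_eq_self h, symmetrizerDiag, symmetrizerOffDiag, if_pos h, if_pos h, mul_one,
      mul_zero, sub_zero]
    rw [shift_eq_zero hκ h, reflSign, if_pos h.le, mul_one, add_zero] at hA
    exact hasSym_iff_coeff.1 hA n
  · have h' := reflCol_ne_reflIdx hc h
    have hκ' : κ (reflCol d c q).2 (reflCol d c q).1 = -κ q.2 q.1 := hκ q.2 q.1
    rw [reflSign_reflCol hc h, hκ', hasSym_iff_coeff] at hA'
    rw [hasSym_iff_coeff] at hA
    simp only [AddMonoidAlgebra.coeff_sub, Finsupp.sub_apply, coeff_mul_symmetrizerDiag h,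
      coeff_mul_symmetrizerOffDiag h, coeff_mul_symmetrizerDiag h', hκ', reflSign_reflCol hc h,
      coeff_mul_symmetrizerOffDiag h']
    rw [hA n, hA' (n - κ q.2 q.1)]
    simp only [Units.val_mul, Units.val_neg, Int.cast_mul, Int.cast_neg]
    rw [show S + -κ q.2 q.1 - (n - κ q.2 q.1) = S - n by ring,
      show S - n - -κ q.2 q.1 = S + κ q.2 q.1 - n by ring]
    linear_combination (((√2 : ℝ) : ℂ)⁻¹ * ((e : ℤ) : ℂ) *
      (A i (reflCol d c q)).coeff (S - n)) *
      units_cast_mul_self (reflSign d c q.2 q.1)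

theorem inv_sqrt_two_mem {F : Subfield ℂ}
    (hsqrt : ∀ y : ℝ, 0 < y → (y : ℂ) ∈ F → ((√y : ℝ) : ℂ) ∈ F) : ((√2 : ℝ) : ℂ)⁻¹ ∈ F :=
  F.inv_mem (hsqrt 2 (by norm_num) (by simp))

theorem coeffsIn_symmetrizer {F : Subfield ℂ}
    (hsqrt : ∀ y : ℝ, 0 < y → (y : ℂ) ∈ F → ((√y : ℝ) : ℂ) ∈ F) :
    CoeffsIn F (symmetrizer d c κ) := by
  rw [coeffsIn_iff]
  intro p q
  have h := inv_sqrt_two_mem hsqrt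
  rw [symmetrizer_apply, symmetrizerDiag, symmetrizerOffDiag]
  refine add_mem ?_ ?_
  · split_ifs
    · exact one_mem _
    · exact C_mem_coeffSubring h
    · exact zero_mem _
  · split_ifs
    · exact zero_mem _
    · exact mul_mem (C_mem_coeffSubring (mul_mem h (intCast_mem F _))) (T_mem_coeffSubring _)
    · exact zero_mem _

end Symmetrizer

/-! ### Shortest shifts -/

theorem finsetLength_le_finsetLength {A B : Finset ℤ}
    (h : ∀ a ∈ A, ∀ b ∈ A, ∃ a' ∈ B, ∃ b' ∈ B, a - b ≤ a' - b') :
    finsetLength A ≤ finsetLength B := by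
  by_cases hB : B.Nonempty
  · have hB' : finsetLength B = ((B.max' hB - B.min' hB : ℤ) : WithBot ℤ) := dif_pos hB
    rw [hB']
    refine finsetLength_le fun a ha b hb => ?_
    obtain ⟨a', ha', b', hb', hle⟩ := h a ha b hb
    have h1 := Finset.le_max' _ a' ha'
    have h2 := Finset.min'_le _ b' hb'
    omega
  · have hA : ¬ A.Nonempty := fun ⟨a, ha⟩ => by
      obtain ⟨a', ha', -⟩ := h a ha a ha
      exact hB ⟨a', ha'⟩
    rw [finsetLength, dif_neg hA]
    exact bot_le

section VecCoeffLength

variable {m : Type*} [Fintype m]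

theorem mem_vecSupport {v : m → ℂ[T;T⁻¹]} {k : ℤ} :
    k ∈ (Finset.univ.biUnion fun i => (v i).coeff.support) ↔ ∃ i, (v i).coeff k ≠ 0 := by
  simp

theorem vecCoeffLength_T_mul_le (v : m → ℂ[T;T⁻¹]) (n : ℤ) :
    vecCoeffLength (fun i => T n * v i) ≤ vecCoeffLength v := by
  refine finsetLength_le_finsetLength fun a ha b hb => ?_
  simp only [mem_vecSupport, coeff_T_mul] at ha hb
  exact ⟨a - n, mem_vecSupport.2 ha, b - n, mem_vecSupport.2 hb, by omega⟩

theorem vecCoeffLength_T_mul (v : m → ℂ[T;T⁻¹]) (n : ℤ) :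
    vecCoeffLength (fun i => T n * v i) = vecCoeffLength v := by
  refine le_antisymm (vecCoeffLength_T_mul_le v n) ?_
  have h := vecCoeffLength_T_mul_le (fun i => T n * v i) (-n)
  simpa only [← mul_assoc, ← T_add, neg_add_cancel, T_zero, one_mul] using h

theorem vecCoeffLength_add_T_mul (u v : m → ℂ[T;T⁻¹]) (n : ℤ) :
    vecCoeffLength (fun i => u i + T n * v i) = vecCoeffLength fun i => v i + T (-n) * u i := by
  rw [← vecCoeffLength_T_mul _ (-n)]
  congr 1; funext i
  rw [mul_add, ← mul_assoc, ← T_add, neg_add_cancel, T_zero, one_mul, add_comm]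

/-- The extreme terms of `v + zⁿ v` cannot cancel. -/
theorem vecCoeffLength_add_self_le (v : m → ℂ[T;T⁻¹]) (n : ℤ) :
    vecCoeffLength (fun i => v i + T 0 * v i) ≤ vecCoeffLength fun i => v i + T n * v i := by
  set B := Finset.univ.biUnion fun i => (v i).coeff.support with hB
  have h0 : ∀ k, (∃ i, (v i + T 0 * v i).coeff k ≠ 0) → k ∈ B := by
    rintro k ⟨i, hi⟩
    refine mem_vecSupport.2 ⟨i, fun h => hi ?_⟩
    rw [T_zero, one_mul, AddMonoidAlgebra.coeff_add, Finsupp.add_apply, h, add_zero]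
  rcases eq_or_ne n 0 with rfl | hn
  · exact le_rfl
  refine finsetLength_le_finsetLength fun a ha b hb => ?_
  have ha' := h0 a (mem_vecSupport.1 ha)
  have hb' := h0 b (mem_vecSupport.1 hb)
  have hne : B.Nonempty := ⟨a, ha'⟩
  have hc : ∀ i k, (v i + T n * v i).coeff k = (v i).coeff k + (v i).coeff (k - n) := fun i k => by
    rw [AddMonoidAlgebra.coeff_add, Finsupp.add_apply, coeff_T_mul]
  have hout : ∀ i k, k ∉ B → (v i).coeff k = 0 := fun i k hk => by
    by_contra h; exact hk (mem_vecSupport.2 ⟨i, h⟩)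
  have hmax : ∀ i k, B.max' hne < k → (v i).coeff k = 0 := fun i k hk =>
    hout i k fun h => absurd (Finset.le_max' B k h) (not_le.2 hk)
  have hmin : ∀ i k, k < B.min' hne → (v i).coeff k = 0 := fun i k hk =>
    hout i k fun h => absurd (Finset.min'_le B k h) (not_le.2 hk)
  obtain ⟨i, hi⟩ := mem_vecSupport.1 (Finset.max'_mem B hne)
  obtain ⟨j, hj⟩ := mem_vecSupport.1 (Finset.min'_mem B hne)
  have h1 := Finset.le_max' B a ha'
  have h2 := Finset.min'_le B b hb'
  rcases lt_or_gt_of_ne hn with hn | hn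
  · refine ⟨B.max' hne, mem_vecSupport.2 ⟨i, ?_⟩, B.min' hne + n, mem_vecSupport.2 ⟨j, ?_⟩,
      by omega⟩
    · rw [hc, hmax i (B.max' hne - n) (by omega), add_zero]; exact hi
    · rw [hc, hmin j (B.min' hne + n) (by omega), add_sub_cancel_right, zero_add]; exact hj
  · refine ⟨B.max' hne + n, mem_vecSupport.2 ⟨i, ?_⟩, B.min' hne, mem_vecSupport.2 ⟨j, ?_⟩,
      by omega⟩
    · rw [hc, hmax i (B.max' hne + n) (by omega), add_sub_cancel_right, zero_add]; exact hi
    · rw [hc, hmin j (B.min' hne - n) (by omega), add_zero]; exact hj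

theorem vecCoeffLength_eq_bot_or_nonneg (v : m → ℂ[T;T⁻¹]) :
    vecCoeffLength v = ⊥ ∨ ∃ N : ℕ, vecCoeffLength v = ((N : ℤ) : WithBot ℤ) := by
  rw [vecCoeffLength, finsetLength]
  split_ifs with h
  · right
    have h1 := Finset.min'_le_max' _ h
    exact ⟨(Finset.max' _ h - Finset.min' _ h).toNat, by rw [Int.toNat_of_nonneg (by omega)]⟩
  · exact Or.inl rfl

theorem exists_minimal_vecCoeffLength (f : ℤ → m → ℂ[T;T⁻¹]) :
    ∃ k, ∀ n, vecCoeffLength (f k) ≤ vecCoeffLength (f n) := by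
  by_cases h : ∃ k, vecCoeffLength (f k) = ⊥
  · obtain ⟨k, hk⟩ := h
    exact ⟨k, fun n => hk ▸ bot_le⟩
  · choose N hN using fun k =>
      (vecCoeffLength_eq_bot_or_nonneg (f k)).resolve_left fun hk => h ⟨k, hk⟩
    refine ⟨Function.argmin N, fun n => ?_⟩
    rw [hN, hN]
    exact_mod_cast Function.argmin_le N n

end VecCoeffLength

/-- For a pair `γ ≠ Q_j^γ` one of the two shifts may be chosen freely, and it is minimal together
with its opposite, since the two vectors differ by a monomial factor. For `γ = Q_j^γ` the shift has
to be `0`, which is minimal by `vecCoeffLength_add_self_le`. -/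
theorem exists_isMinimalShift {r d : ℕ} [NeZero d] {c : Fin r → ℝ}
    (hc : ∀ l j, ∃ n : ℤ, (n : ℝ) = d * c l - c j) (a : LMat (Fin r) (Fin r)) :
    ∃ κ, IsShift d c κ ∧ IsMinimalShift d a c κ := by
  choose μ hμ using fun (j : Fin r) (γ : Fin d) => exists_minimal_vecCoeffLength fun n l =>
    subsymbol d a (γ : ℕ) l j + T n * subsymbol d a (reflIdx d c j γ : ℕ) l j
  set κ : Fin r → Fin d → ℤ := fun j γ =>
    if γ = reflIdx d c j γ then 0 else if γ < reflIdx d c j γ then μ j γ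
      else -μ j (reflIdx d c j γ) with hκ
  refine ⟨κ, fun j γ => ?_, fun j γ n => ?_⟩
  · have h0 := reflIdx_reflIdx hc j γ
    simp only [hκ, h0]
    rcases lt_trichotomy γ (reflIdx d c j γ) with h | h | h
    · rw [if_neg h.ne', if_neg h.not_gt, if_neg h.ne, if_pos h]
    · rw [if_pos h.symm, if_pos h, neg_zero]
    · rw [if_neg h.ne, if_pos h, if_neg h.ne', if_neg h.not_gt, neg_neg]
  · have h0 := reflIdx_reflIdx hc j γ
    rcases lt_trichotomy γ (reflIdx d c j γ) with h | h | h
    · rw [show κ j γ = μ j γ by simp only [hκ]; rw [if_neg h.ne, if_pos h]]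
      exact hμ j γ n
    · rw [show κ j γ = 0 by simp only [hκ]; rw [if_pos h], ← h]
      exact vecCoeffLength_add_self_le _ n
    · rw [show κ j γ = -μ j (reflIdx d c j γ) by
        simp only [hκ]; rw [if_neg h.ne', if_neg h.not_gt]]
      have h1 := hμ j (reflIdx d c j γ) (-n)
      rw [h0] at h1
      rw [vecCoeffLength_add_T_mul, vecCoeffLength_add_T_mul _ _ n, neg_neg]
      exact h1

/-! ### Filters and their polyphase matrices -/

section Polyphase

variable {r d : ℕ} [NeZero d]

theorem polyphaseRow_mul_conjTranspose {a : LMat (Fin r) (Fin r)} (h : IsOrthogonalFilter d a) :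
    polyphaseRow d a * (polyphaseRow d a)ᴴ = 1 := by
  rw [← (show _ = (1 : LMat (Fin r) (Fin r)) from h)]
  refine Matrix.ext fun l l' => ?_
  rw [Matrix.mul_apply, Fintype.sum_prod_type, Matrix.sum_apply]
  rfl

theorem coeffsIn_polyphaseRow {F : Subfield ℂ}
    (hsqrt : ∀ y : ℝ, 0 < y → (y : ℂ) ∈ F → ((√y : ℝ) : ℂ) ∈ F)
    {a : LMat (Fin r) (Fin r)} (ha : CoeffsIn F a) : CoeffsIn F (polyphaseRow d a) := by
  intro l q k
  rw [polyphaseRow, Matrix.of_apply, subsymbol_coeff]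
  exact F.mul_mem (hsqrt d (by exact_mod_cast Nat.pos_of_ne_zero (NeZero.ne d)) (by simp))
    (ha _ _ _)

theorem filterOfPolyphase_coeff (A : LMat (Fin d × Fin r) (Fin d × Fin r)) (m γ : Fin d)
    (l j : Fin r) (k : ℤ) : (filterOfPolyphase d A m l j).coeff ((γ : ℕ) + d * k) =
      ((√(d : ℝ) : ℝ) : ℂ)⁻¹ * (A (m, l) (γ, j)).coeff k := by
  have hd : (d : ℤ) ≠ 0 := by exact_mod_cast NeZero.ne d
  have hinj : Function.Injective fun n : ℤ => (d : ℤ) * n := fun x y h => mul_left_cancel₀ hd h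
  rw [filterOfPolyphase, Matrix.of_apply, coeff_C_mul, AddMonoidAlgebra.coeff_sum,
    Finset.sum_apply']
  congr 1
  rw [Finset.sum_eq_single γ]
  · rw [mul_comm, coeff_T_mul, add_sub_cancel_left]
    exact Finsupp.mapDomain_apply hinj _ k
  · intro γ' _ hne
    rw [mul_comm, coeff_T_mul]
    refine Finsupp.mapDomain_of_notMem_range _ _ ?_
    rintro ⟨n, hn⟩
    exact hne (Int.eq_and_eq_of_mul_add_eq (R := n) (R' := k) (by
      have : (d : ℤ) * n = (γ : ℕ) + d * k - (γ' : ℕ) := hn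
      linarith)).2
  · intro h; exact absurd (Finset.mem_univ _) h

theorem subsymbol_filterOfPolyphase (A : LMat (Fin d × Fin r) (Fin d × Fin r)) (m γ : Fin d)
    (l j : Fin r) :
    subsymbol d (filterOfPolyphase d A m) (γ : ℕ) l j = A (m, l) (γ, j) := by
  ext k
  rw [subsymbol_coeff, filterOfPolyphase_coeff, mul_inv_cancel_left₀ sqrt_natCast_ne_zero]

theorem polyphase_filterOfPolyphase (A : LMat (Fin d × Fin r) (Fin d × Fin r)) :
    polyphase d (filterOfPolyphase d A) = A :=
  Matrix.ext fun p q => subsymbol_filterOfPolyphase A p.1 q.1 p.2 q.2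

theorem filterOfPolyphase_eq {A : LMat (Fin d × Fin r) (Fin d × Fin r)} {m : Fin d}
    {a : LMat (Fin r) (Fin r)} (h : ∀ l q, A (m, l) q = polyphaseRow d a l q) :
    filterOfPolyphase d A m = a := by
  refine Matrix.ext fun l j => LaurentPolynomial.ext fun n => ?_
  obtain ⟨γ, k, rfl⟩ := exists_eq_add_mul (d := d) n
  rw [filterOfPolyphase_coeff, h, polyphaseRow, Matrix.of_apply, subsymbol_coeff,
    inv_mul_cancel_left₀ sqrt_natCast_ne_zero]

theorem coeffsIn_filterOfPolyphase {F : Subfield ℂ}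
    (hsqrt : ∀ y : ℝ, 0 < y → (y : ℂ) ∈ F → ((√y : ℝ) : ℂ) ∈ F)
    {A : LMat (Fin d × Fin r) (Fin d × Fin r)} (hA : CoeffsIn F A) (m : Fin d) :
    CoeffsIn F (filterOfPolyphase d A m) := by
  intro l j n
  obtain ⟨γ, k, rfl⟩ := exists_eq_add_mul (d := d) n
  rw [filterOfPolyphase_coeff]
  exact F.mul_mem (F.inv_mem
    (hsqrt d (by exact_mod_cast Nat.pos_of_ne_zero (NeZero.ne d)) (by simp))) (hA _ _ _)

end Polyphase

/-! ### Symmetry of the filters -/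

section Symmetry

variable {r d : ℕ} [NeZero d] {ε : Fin r → ℤˣ} {c : Fin r → ℝ} {κ : Fin r → Fin d → ℤ}
  {k : Fin r → ℤ} {t : Fin d × Fin r → ℤ}

theorem hasSymPattern_polyphaseRow_mul_symmetrizer {a : LMat (Fin r) (Fin r)}
    (hsym : FilterSym d a ε c ε c) (hκ : IsShift d c κ) (hkt : IsExponentSplit d c κ k t) :
    HasSymPattern (polyphaseRow d a * symmetrizer d c κ) (fun l => (ε l, k l))
      (fun q => (reflSign d c q.2 q.1 * ε q.2, t q)) := by
  have hc : ∀ l j, ∃ n : ℤ, (n : ℝ) = d * c l - c j := fun l j => (hsym l j).imp fun n h => h.1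
  intro l q
  obtain ⟨n, hn, hs⟩ := hsym l q.2
  have h := hasSym_mul_symmetrizer hκ (A := polyphaseRow d a) (i := l) (q := q) fun m =>
    (hasSym_iff_subsymbol_coeff (sub_eq_mul_reflQuot_add_reflIdx hc hn)).1 hs q.1 m
  rw [← hkt l q.2 q.1, mul_right_comm, mul_assoc] at h
  exact h

/-- The rows of block `m` of `P_e U*` are the polyphase components of a symmetric filter. -/
theorem filterSym_filterOfPolyphase (hc : ∀ l j, ∃ n : ℤ, (n : ℝ) = d * c l - c j)
    (hκ : IsShift d c κ) (hkt : IsExponentSplit d c κ k t)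
    {A : LMat (Fin d × Fin r) (Fin d × Fin r)} {E : Fin d × Fin r → ℤˣ}
    {K : Fin d × Fin r → ℤ}
    (hA : HasSymPattern A (fun p => (E p, K p))
      (fun q => (reflSign d c q.2 q.1 * ε q.2, t q))) (m : Fin d) :
    FilterSym d (filterOfPolyphase d (A * (symmetrizer d c κ)ᴴ) m) (fun l => E (m, l))
      (fun l => ((K (m, l) - k l : ℤ) : ℝ) + c l) ε c := by
  intro l j
  obtain ⟨n, hn⟩ := hc l j
  refine ⟨n + d * (K (m, l) - k l), by push_cast; rw [hn]; ring, ?_⟩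
  have hR : ∀ γ : Fin d, n + d * (K (m, l) - k l) - (γ : ℕ) =
      d * (reflQuot d c l j γ + (K (m, l) - k l)) + (reflIdx d c j γ : ℕ) := fun γ => by
    linarith [sub_eq_mul_reflQuot_add_reflIdx hc hn γ]
  rw [hasSym_iff_subsymbol_coeff hR]
  intro γ x
  rw [subsymbol_filterOfPolyphase, subsymbol_filterOfPolyphase]
  have hS : ∀ γ', HasSym (A (m, l) (γ', j)) (E (m, l) * ε j * reflSign d c j γ')
      (reflQuot d c l j γ' + (K (m, l) - k l) + κ j γ') := fun γ' => by
    have h1 := hA (m, l) (γ', j)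
    have h2 : K (m, l) + t (γ', j) = reflQuot d c l j γ' + (K (m, l) - k l) + κ j γ' := by
      linarith [hkt l j γ']
    rw [← h2, mul_right_comm, mul_assoc]
    exact h1
  have h3 := hS (reflIdx d c j γ)
  rw [reflQuot_reflIdx hc] at h3
  exact coeff_mul_symmetrizer_conjTranspose hc hκ (q := (γ, j)) (hS γ) h3 x

end Symmetry

theorem mainTheorem3
    (F : Subfield ℂ) (hconj : ∀ x ∈ F, (starRingEnd ℂ) x ∈ F)
    (hsqrt : ∀ y : ℝ, 0 < y → (y : ℂ) ∈ F → ((√y : ℝ) : ℂ) ∈ F)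
    (d r : ℕ) [NeZero d] (hd : 2 ≤ d)
    (a₀ : LMat (Fin r) (Fin r)) (ha₀ : CoeffsIn F a₀) (horth : IsOrthogonalFilter d a₀)
    (ε : Fin r → ℤˣ) (c : Fin r → ℝ) (hsym : FilterSym d a₀ ε c ε c) :
    (∃ κ : Fin r → Fin d → ℤ, IsShift d c κ ∧ IsMinimalShift d a₀ c κ) ∧
    ∀ κ : Fin r → Fin d → ℤ, IsShift d c κ →
      CoeffsIn F (symmetrizer d c κ) ∧ IsParaunitary (symmetrizer d c κ) ∧
      (∃ k t, IsExponentSplit d c κ k t) ∧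
      ∀ k t, IsExponentSplit d c κ k t →
        HasSymPattern (polyphaseRow d a₀ * symmetrizer d c κ)
          (fun l => (ε l, k l)) (fun q => (reflSign d c q.2 q.1 * ε q.2, t q)) ∧
        (∃ Pe E K,
          IsSymExtension F (polyphaseRow d a₀ * symmetrizer d c κ)
            (fun l => (ε l, k l)) (fun q => (reflSign d c q.2 q.1 * ε q.2, t q)) Pe E K ∧
          ∀ p q, coeffLength (Pe p q) ≤
            max 0 (Finset.univ.sup fun l : Fin r =>
              coeffLength ((polyphaseRow d a₀ * symmetrizer d c κ) l q))) ∧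
        ∀ Pe E K,
          IsSymExtension F (polyphaseRow d a₀ * symmetrizer d c κ)
            (fun l => (ε l, k l)) (fun q => (reflSign d c q.2 q.1 * ε q.2, t q)) Pe E K →
          filterOfPolyphase d (Pe * pstar (symmetrizer d c κ)) 0 = a₀ ∧
          polyphase d (filterOfPolyphase d (Pe * pstar (symmetrizer d c κ)))
            = Pe * pstar (symmetrizer d c κ) ∧
          IsParaunitary (polyphase d (filterOfPolyphase d (Pe * pstar (symmetrizer d c κ)))) ∧
          ∀ m : Fin d, m ≠ 0 →
            CoeffsIn F (filterOfPolyphase d (Pe * pstar (symmetrizer d c κ)) m) ∧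
            FilterSym d (filterOfPolyphase d (Pe * pstar (symmetrizer d c κ)) m)
              (fun l => E (m, l)) (fun l => ((K (m, l) - k l : ℤ) : ℝ) + c l) ε c := by

  have hc : ∀ l j, ∃ n : ℤ, (n : ℝ) = d * c l - c j := fun l j => (hsym l j).imp fun n h => h.1
  refine ⟨exists_isMinimalShift hc a₀, fun κ hκ => ?_⟩
  have hU : symmetrizer d c κ * (symmetrizer d c κ)ᴴ = 1 := isParaunitary_symmetrizer hc hκ
  have hUF : CoeffsIn F (symmetrizer d c κ) := coeffsIn_symmetrizer hsqrt
  have hP : polyphaseRow d a₀ * symmetrizer d c κ *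
      (polyphaseRow d a₀ * symmetrizer d c κ)ᴴ = 1 := by
    rw [Matrix.conjTranspose_mul, Matrix.mul_assoc, ← Matrix.mul_assoc (symmetrizer d c κ), hU,
      Matrix.one_mul, polyphaseRow_mul_conjTranspose horth]
  have hPF : CoeffsIn F (polyphaseRow d a₀ * symmetrizer d c κ) :=
    coeffsIn_iff.2 ((coeffsIn_iff.1 (coeffsIn_polyphaseRow hsqrt ha₀)).mul (coeffsIn_iff.1 hUF))
  refine ⟨hUF, hU, exists_isExponentSplit hc κ, fun k t hkt => ?_⟩
  have hpat := hasSymPattern_polyphaseRow_mul_symmetrizer hsym hκ hkt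
  refine ⟨hpat, exists_isSymExtension hconj hsqrt hPF hP hpat, fun Pe E K hPe => ?_⟩
  have hPe1 : Pe * Peᴴ = 1 := hPe.paraunitary
  rw [polyphase_filterOfPolyphase]
  refine ⟨filterOfPolyphase_eq fun l q => ?_, rfl, ?_, fun m _ => ⟨?_, ?_⟩⟩
  · have h : ∀ q, (Pe * pstar (symmetrizer d c κ)) (0, l) q =
        (polyphaseRow d a₀ * symmetrizer d c κ * (symmetrizer d c κ)ᴴ) l q := fun q => by
      rw [Matrix.mul_apply, Matrix.mul_apply]
      exact Finset.sum_congr rfl fun p _ => by rw [hPe.top]; rfl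
    rw [h, Matrix.mul_assoc, hU, Matrix.mul_one]
  · change Pe * (symmetrizer d c κ)ᴴ * (Pe * (symmetrizer d c κ)ᴴ)ᴴ = 1
    rw [Matrix.conjTranspose_mul, Matrix.conjTranspose_conjTranspose, Matrix.mul_assoc,
      ← Matrix.mul_assoc (symmetrizer d c κ)ᴴ, mul_eq_one_comm.1 hU, Matrix.one_mul, hPe1]
  · exact coeffsIn_filterOfPolyphase hsqrt (coeffsIn_iff.2 ((coeffsIn_iff.1 hPe.coeffs).mul
      ((coeffsIn_iff.1 hUF).conjTranspose fun x hx => star_mem_coeffSubring hconj hx))) m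
  · exact filterSym_filterOfPolyphase hc hκ hkt hPe.pattern m
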